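/- Let $n\ge 1$. For $\boldsymbol\xi=(\xi_1,\dots,\xi_n)\in\mathbb R^n$ and real $t\ge 1$ put $$\psi_{\boldsymbol\xi}(t)=\min\Big\{|b_1\xi_1+\dots+b_n\xi_n+b_{n+1}| : (b_1,\dots,b_{n+1})\in\mathbb Z^{n+1},\ 1\le \max_{1\le i\le n}|b_i|\le t\Big\}.$$ The Dirichlet constant of $\boldsymbol\xi$ is $\Theta(\boldsymbol\xi)=\limsup_{t\to\infty}t^n\psi_{\boldsymbol\xi}(t)$, and $\boldsymbol\xi$ is called badly approximable if $\liminf_{t\to\infty}t^n\psi_{\boldsymbol\xi}(t)>0$. For a real number $c\ge 0$ let $$FS_n(c)=\{\boldsymbol\xi\in\mathbb R^n : \Theta(\boldsymbol\xi)=c \text{ and } \boldsymbol\xi \text{ is not badly approximable}\}.$$ Theorem. Let $n\ge 4$ be an integer and $$c_n=\frac{n-3}{8(n-2)^{3/2}}\cdot\sqrt{\pi}\cdot\frac{\Gamma(n-\frac12)}{\Gamma(n)},$$ where $\Gamma$ is the Euler Gamma function. Then $c_n\in(0,1)$, and for every real $c\in[0,c_n)$ the Hausdorff dimension of $FS_n(c)$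 satisfies $$\dim_H FS_n(c)\ge n-2.$$ -/

import Mathlib

open Filter Topology
open scoped ENNReal

noncomputable section

namespace Folklore

/-- The best approximation function of the linear form `x ↦ x₁ ξ₁ + ⋯ + xₙ ξₙ`:
the minimum of `|b₁ ξ₁ + ⋯ + bₙ ξₙ + a|` over all integers `b₁, …, bₙ, a` with
`1 ≤ max |bᵢ| ≤ t`.  (The norm on `Fin n → ℤ` is the maximum norm.  For `n ≥ 1` and `t ≥ 1` the set
below is non-empty, and its infimum is attained since only finitely many `b` occur.) -/
def psi {n : ℕ} (ξ : Fin n → ℝ) (t : ℝ) : ℝ :=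
  sInf {r : ℝ | ∃ (b : Fin n → ℤ) (a : ℤ),
    1 ≤ ‖b‖ ∧ ‖b‖ ≤ t ∧ r = |∑ i, (b i : ℝ) * ξ i + (a : ℝ)|}

/-- The Dirichlet constant `limsup_{t → ∞} tⁿ ψ_ξ(t)`, taken in the extended reals. -/
def dirichletConst {n : ℕ} (ξ : Fin n → ℝ) : EReal :=
  limsup (fun t : ℝ => ((t ^ n * psi ξ t : ℝ) : EReal)) atTop

/-- The asymptotic constant `liminf_{t → ∞} tⁿ ψ_ξ(t)`, taken in the extended reals. -/
def asympConst {n : ℕ} (ξ : Fin n → ℝ) : EReal :=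
  liminf (fun t : ℝ => ((t ^ n * psi ξ t : ℝ) : EReal)) atTop

/-- The badly approximable linear forms in `n` variables. -/
def Bad (n : ℕ) : Set (Fin n → ℝ) := {ξ | 0 < asympConst ξ}

/-- The linear forms in `n` variables with Dirichlet constant exactly `c`. -/
def DI (n : ℕ) (c : ℝ) : Set (Fin n → ℝ) := {ξ | dirichletConst ξ = (c : EReal)}

/-- The refined Folklore set: Dirichlet constant exactly `c`, not badly approximable.
(For `c > 0` its members are automatically not singular, singular meaning Dirichlet constant `0`.) -/
def FS (n : ℕ) (c : ℝ) : Set (Fin n → ℝ) := DI n c \ Bad n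

/-- The explicit constant `(n-3) / (8 (n-2)^{3/2}) · √π · Γ(n - 1/2) / Γ(n)`. -/
def threshold (n : ℕ) : ℝ :=
  ((n : ℝ) - 3) / (8 * ((n : ℝ) - 2) ^ (3 / 2 : ℝ)) * √Real.pi *
    (Real.Gamma ((n : ℝ) - 1 / 2) / Real.Gamma (n : ℝ))

end Folklore

end

/-!
Write `n = d + 2`. The bound on the dimension holds for every `c ∈ [0, 1)`, and the threshold is
smaller than `1`: a single pair `(x, y)` is found such that `(θ, x, y)` has Dirichlet constant `c`
and is not badly approximable for all `θ` in a subset of `ℝ ^ d` of positive Lebesgue measure.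
Projecting to the first `d` coordinates then gives dimension at least `d`.

**The pair.** The numbers `x` and `y` are limits of fractions `p k / q k` with rapidly growing prime
denominators, `k` even for `x` and `k` odd for `y`, chosen so that the error
`q k * z - p k`, where `z` is the respective number, equals `c / q (k + 1) ^ n` up to a factor
tending to `1` (or is `o (1 / q (k + 1) ^ n)` if `c = 0`); see `exists_interlaced`. These forms
alone show that the Dirichlet constant is at most `c` and that the point is not badly approximable.
It is at least `c` as soon as, for infinitely many `k`, no form of height below `r = q (k + 1)`
takes a value smaller than `q k * z - p k`. After multiplication by `q k * r` a form in
`(θ, x, y)` with coefficients `(b, u, v)` is an integer plus `b · (q k r θ)`, up to a small error, so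
that it is enough that `|b · η + m| ≥ c' / r ^ d` for `η = q k r θ`, all integers `m` and all
nonzero integer vectors `b` with `|bᵢ| < r`, for some fixed `c' ∈ (c, 1)`; see
`le_abs_linear_form`. The set of these `η` is `AvoidSet d r c'`.

**The points `θ`.** As `AvoidSet d r c'` is periodic, and multiplication by an integer preserves the
volume of periodic sets, the reverse Fatou inequality reduces the problem to a lower bound for the
volume of `AvoidSet d r c'` in a unit cube which is uniform in `r`; this is
`exists_volume_avoidSet_ge`. A union bound over `b` would only allow `c' < 2 ^ (-d)` or so, which
is not sufficient for large `d`. Instead, consider integer matrices `(B | m)` of size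
`d × (d + 1)`, where `B` is close to `r` times the identity, and the cell of points `η` for which
all entries of `B η + m` are at most `ε / r ^ d`. If `(B | m)` is primitive, i.e. has rank `d`
modulo every prime, its cell lies in `AvoidSet d r c'`: by integrality a short almost relation of
`η` would be a rational combination of the rows with coefficients less than `1`
(`mem_avoidSet_of_primitive`). Cells of different primitive matrices are disjoint
(`eq_of_mem_gridCell`). There are about `r ^ (d (d + 1))` matrices and each cell has volume about
`r ^ (-d (d + 1))`, so it remains to see that a positive proportion of the matrices is primitive,
which is the sieve argument of `exists_primitive_card_ge`.
-/

namespace Folklore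

open Finset

/-! ### Counting integer matrices modulo a prime -/

/-- Counting functions by the fibres of forgetting one coordinate. -/
lemma card_le_of_update {ι α : Type*} [Fintype ι] [DecidableEq ι] [Fintype α] [DecidableEq α]
    (i₀ : ι) (S : Finset (ι → α)) (K : ℕ)
    (h : ∀ g : ι → α, #{x | Function.update g i₀ x ∈ S} ≤ K) :
    #S ≤ K * Fintype.card α ^ (Fintype.card ι - 1) := by
  classical
  have h1 : #S ≤ K * #(univ : Finset ({i // i ≠ i₀} → α)) := by
    refine card_le_mul_card_image_of_maps_to (f := fun f i => f i.1) (fun _ _ => mem_univ _) K ?_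
    intro r _
    rcases (S.filter fun f => (fun i : {i // i ≠ i₀} => f i.1) = r).eq_empty_or_nonempty with
      he | ⟨g, hg⟩
    · rw [he]; simp
    refine le_trans (card_le_card_of_injOn (fun f => f i₀) ?_ ?_) (h g)
    · intro f hf
      simp only [coe_filter, Set.mem_ofPred_eq, mem_filter, mem_univ, true_and] at hf hg ⊢
      have : Function.update g i₀ (f i₀) = f := by
        funext i
        by_cases hi : i = i₀
        · subst hi; simp
        · rw [Function.update_of_ne hi]
          exact (congrFun hg.2 ⟨i, hi⟩).trans (congrFun hf.2 ⟨i, hi⟩).symm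
      rw [this]; exact hf.1
    · intro f hf f' hf' hff
      simp only [coe_filter, Set.mem_ofPred_eq] at hf hf'
      funext i
      by_cases hi : i = i₀
      · subst hi; exact hff
      · exact (congrFun hf.2 ⟨i, hi⟩).trans (congrFun hf'.2 ⟨i, hi⟩).symm
  refine h1.trans (le_of_eq ?_)
  rw [card_univ, Fintype.card_fun, Fintype.card_subtype_compl, Fintype.card_subtype_eq]

lemma card_residue_le {p : ℕ} [Fact p.Prime] (ℓ : ℕ) {M : ZMod p} (hM : M ≠ 0) (a : ZMod p) :
    #{t : Fin ℓ | M * ((t : ℕ) : ZMod p) = a} ≤ ℓ / p + 1 := by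
  have hp : 0 < p := (Fact.out : p.Prime).pos
  rw [← card_range (ℓ / p + 1)]
  refine card_le_card_of_injOn (fun t => (t : ℕ) / p) ?_ ?_
  · intro t _
    simp only [coe_range, Set.mem_Iio]
    exact Nat.lt_succ_of_le (Nat.div_le_div_right t.2.le)
  · intro t ht t' ht' h
    simp only [coe_filter, mem_univ, true_and, Set.mem_ofPred_eq] at ht ht' h
    have h1 : ((t : ℕ) : ZMod p) = ((t' : ℕ) : ZMod p) := mul_left_cancel₀ hM (ht.trans ht'.symm)
    have h2 : (t : ℕ) % p = (t' : ℕ) % p := (ZMod.natCast_eq_natCast_iff' _ _ _).1 h1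
    apply Fin.ext
    rw [← Nat.div_add_mod (t : ℕ) p, ← Nat.div_add_mod (t' : ℕ) p, h, h2]

lemma card_hyperplane_le {d p : ℕ} [Fact p.Prime] (ℓ : ℕ) {M : ZMod p} (hM : M ≠ 0)
    (s w : Fin d → ZMod p) {i₀ : Fin d} (hw : w i₀ ≠ 0) :
    #{t : Fin d → Fin ℓ | ∑ i, w i * (s i + M * ((t i : ℕ) : ZMod p)) = 0}
      ≤ (ℓ / p + 1) * ℓ ^ (d - 1) := by
  classical
  have := card_le_of_update i₀
    {t : Fin d → Fin ℓ | ∑ i, w i * (s i + M * ((t i : ℕ) : ZMod p)) = 0} (ℓ / p + 1) (fun g => ?_)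
  · simpa using this
  refine le_trans (card_le_card ?_) (card_residue_le ℓ hM
    (-(s i₀) - (w i₀)⁻¹ * ∑ i ∈ univ.erase i₀, w i * (s i + M * ((g i : ℕ) : ZMod p))))
  intro x hx
  simp only [mem_filter, mem_univ, true_and] at hx ⊢
  rw [← add_sum_erase _ _ (mem_univ i₀)] at hx
  have h2 : ∑ i ∈ univ.erase i₀, w i * (s i + M * ((Function.update g i₀ x i : ℕ) : ZMod p))
      = ∑ i ∈ univ.erase i₀, w i * (s i + M * ((g i : ℕ) : ZMod p)) := by
    refine sum_congr rfl fun i hi => ?_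
    rw [Function.update_of_ne (ne_of_mem_erase hi)]
  rw [h2, Function.update_self] at hx
  field_simp
  linear_combination hx

/-- The `j`-th column of the integer matrix `(β I | 0) + M T`, where `T` has the column `t` there. -/
def gridCol {d ℓ : ℕ} (M β : ℕ) (j : Fin (d + 1)) (t : Fin d → Fin ℓ) (i : Fin d) : ℤ :=
  (if j = i.castSucc then (β : ℤ) else 0) + M * ((t i : ℕ) : ℤ)

/-- No nontrivial combination of the rows of `(β I | 0) + M T` vanishes modulo `p`. -/
def PrimitiveAt {d ℓ : ℕ} (M β : ℕ) (T : Fin (d + 1) → Fin d → Fin ℓ) (p : ℕ) : Prop :=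
  ∀ w : Fin d → ZMod p, (∀ j, ∑ i, w i * (gridCol M β j (T j) i : ZMod p) = 0) → w = 0

lemma primitiveAt_of_dvd {d ℓ M β p : ℕ} (T : Fin (d + 1) → Fin d → Fin ℓ)
    (hp : p ∣ M) (hβ : β ≡ 1 [MOD M]) : PrimitiveAt M β T p := by
  intro w hw
  have hM : (M : ZMod p) = 0 := (ZMod.natCast_eq_zero_iff _ _).2 hp
  have hb : (β : ZMod p) = 1 := by
    have := (ZMod.natCast_eq_natCast_iff β 1 p).2 (hβ.of_dvd hp)
    simpa using this
  funext k
  have := hw k.castSucc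
  simpa [gridCol, hM, hb, Fin.castSucc_inj] using this

open Classical in
/-- The union bound over the possible row relations modulo `p`, normalized to have some coefficient
`1`: there are at most `d * p ^ (d - 1)` of them, and each one holds in a given column with
probability at most `2 / p`. -/
lemma card_not_primitiveAt_le {d ℓ M β p : ℕ} [Fact p.Prime] (hM : ¬ p ∣ M) (hpl : p ≤ ℓ)
    (hd : 1 ≤ d) :
    (#{T : Fin (d + 1) → Fin d → Fin ℓ | ¬ PrimitiveAt M β T p} : ℝ)
      ≤ d * 2 ^ (d + 1) * ((p : ℝ) ^ 2)⁻¹ * ℓ ^ (d * (d + 1)) := by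
  have hp : 0 < p := (Fact.out : p.Prime).pos
  have hM' : (M : ZMod p) ≠ 0 := fun h => hM ((ZMod.natCast_eq_zero_iff _ _).1 h)
  let H : (Fin d → ZMod p) → Finset (Fin (d + 1) → Fin d → Fin ℓ) := fun w =>
    Fintype.piFinset fun j => {t | ∑ i, w i * (gridCol M β j t i : ZMod p) = 0}
  let W : Fin d → Finset (Fin d → ZMod p) := fun i₀ => {w | w i₀ = 1}
  have hW : ∀ i₀, #(W i₀) ≤ p ^ (d - 1) := by
    intro i₀
    have := card_le_of_update i₀ (W i₀) 1 (fun g => by simp [W, filter_eq'])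
    simpa [ZMod.card] using this
  have hH : ∀ i₀, ∀ w ∈ W i₀, #(H w) ≤ ((ℓ / p + 1) * ℓ ^ (d - 1)) ^ (d + 1) := by
    intro i₀ w hw
    simp only [W, mem_filter, mem_univ, true_and] at hw
    rw [Fintype.card_piFinset]
    refine (prod_le_pow_card _ _ ((ℓ / p + 1) * ℓ ^ (d - 1)) fun j _ => ?_).trans (by simp)
    have := card_hyperplane_le ℓ hM'
      (fun i => if j = i.castSucc then (β : ZMod p) else 0) w (i₀ := i₀)
      (by rw [hw]; exact one_ne_zero)
    refine le_trans (le_of_eq ?_) this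
    congr 1
    ext t
    simp [gridCol]
  have hsub : ({T : Fin (d + 1) → Fin d → Fin ℓ | ¬ PrimitiveAt M β T p} : Finset _)
      ⊆ univ.biUnion fun i₀ => (W i₀).biUnion H := by
    intro T hT
    simp only [mem_filter, mem_univ, true_and, PrimitiveAt, not_forall] at hT
    obtain ⟨w, hw, hne⟩ := hT
    obtain ⟨i₀, hi₀⟩ := Function.ne_iff.1 hne
    simp only [mem_biUnion, mem_univ, true_and]
    refine ⟨i₀, fun i => (w i₀)⁻¹ * w i, ?_, ?_⟩
    · simpa [W] using inv_mul_cancel₀ hi₀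
    · simp only [H, Fintype.mem_piFinset, mem_filter, mem_univ, true_and]
      intro j
      simp only [mul_assoc, ← mul_sum, hw j, mul_zero]
  have hN : #{T : Fin (d + 1) → Fin d → Fin ℓ | ¬ PrimitiveAt M β T p}
      ≤ d * (p ^ (d - 1) * ((ℓ / p + 1) * ℓ ^ (d - 1)) ^ (d + 1)) := by
    refine (card_le_card hsub).trans ?_
    refine (card_biUnion_le_card_mul _ _ (p ^ (d - 1) * ((ℓ / p + 1) * ℓ ^ (d - 1)) ^ (d + 1))
      fun i₀ _ => ?_).trans (by simp)
    exact (card_biUnion_le_card_mul _ _ _ (hH i₀)).trans (Nat.mul_le_mul_right _ (hW i₀))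
  have hpR : (0 : ℝ) < p := by exact_mod_cast hp
  have h2 : ((ℓ / p + 1 : ℕ) : ℝ) ≤ 2 * ℓ / p := by
    rw [le_div_iff₀ hpR]
    have : (ℓ / p + 1) * p ≤ 2 * ℓ := by
      have := Nat.div_mul_le_self ℓ p
      linarith
    exact_mod_cast this
  obtain ⟨e, rfl⟩ : ∃ e, d = e + 1 := ⟨d - 1, by omega⟩
  calc (#{T : Fin (e + 1 + 1) → Fin (e + 1) → Fin ℓ | ¬ PrimitiveAt M β T p} : ℝ)
      ≤ ((e + 1 : ℕ) : ℝ) * ((p : ℝ) ^ e * (((ℓ / p + 1 : ℕ) : ℝ) * ℓ ^ e) ^ (e + 1 + 1)) := by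
        exact_mod_cast hN
    _ ≤ ((e + 1 : ℕ) : ℝ) * ((p : ℝ) ^ e * ((2 * ℓ / p) * ℓ ^ e) ^ (e + 1 + 1)) := by
        gcongr
    _ = _ := by
        rw [mul_pow, div_pow, mul_pow, show (p : ℝ) ^ (e + 1 + 1) = p ^ e * p ^ 2 by ring]
        field_simp
        ring

/-! ### Determinants, large prime factors and dependent columns -/

lemma abs_det_le_prod_sum {m : Type*} [Fintype m] [DecidableEq m] (A : Matrix m m ℤ) :
    |A.det| ≤ ∏ i, ∑ j, |A i j| := by
  classical
  rw [← Matrix.det_transpose, Matrix.det_apply, Finset.prod_univ_sum]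
  simp only [Matrix.transpose_apply]
  calc |∑ σ : Equiv.Perm m, Equiv.Perm.sign σ • ∏ i, A i (σ i)|
      ≤ ∑ σ : Equiv.Perm m, |Equiv.Perm.sign σ • ∏ i, A i (σ i)| := abs_sum_le_sum_abs _ _
    _ = ∑ σ : Equiv.Perm m, ∏ i, |A i (σ i)| := by
        refine sum_congr rfl fun σ _ => ?_
        rw [← Finset.abs_prod, Units.smul_def, smul_eq_mul, abs_mul]
        rcases Int.units_eq_one_or (Equiv.Perm.sign σ) with h | h <;> simp [h]
    _ = ∑ f ∈ Finset.image (DFunLike.coe : Equiv.Perm m → m → m) univ, ∏ i, |A i (f i)| := by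
        rw [sum_image]
        intro σ _ τ _ h
        exact Equiv.coe_fn_injective h
    _ ≤ ∑ f ∈ Fintype.piFinset fun _ : m => (univ : Finset m), ∏ i, |A i (f i)| := by
        refine sum_le_sum_of_subset_of_nonneg (by intro f _; simp) fun f _ _ => ?_
        exact prod_nonneg fun i _ => abs_nonneg _

/-- An integer of absolute value at most `ℓ ^ k` has at most `k` prime factors exceeding `ℓ`. -/
lemma card_large_primeFactors_le {ℓ k : ℕ} (hℓ : 2 ≤ ℓ) {D : ℕ} (hD : D ≠ 0) (hle : D ≤ ℓ ^ k) :
    #{p ∈ D.primeFactors | ℓ < p} ≤ k := by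
  refine (Nat.pow_le_pow_iff_right (by omega : 1 < ℓ)).1 (le_trans ?_ hle)
  calc ℓ ^ #{p ∈ D.primeFactors | ℓ < p}
      ≤ ∏ p ∈ D.primeFactors with ℓ < p, p := by
        refine pow_card_le_prod _ _ _ fun p hp => ?_
        exact (mem_filter.1 hp).2.le
    _ ≤ ∏ p ∈ D.primeFactors, p :=
        prod_le_prod_of_subset_of_one_le' (filter_subset _ _)
          fun p hp _ => (Nat.prime_of_mem_primeFactors hp).one_le
    _ ≤ D := Nat.le_of_dvd (Nat.pos_of_ne_zero hD) (Nat.prod_primeFactors_dvd D)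

lemma le_finrank_add_card_mem_span {K V : Type*} [Field K] [AddCommGroup V] [Module K V]
    [Module.Finite K V] (v : ℕ → V) [∀ j, Decidable (v j ∈ Submodule.span K (v '' Set.Iio j))]
    (k : ℕ) :
    k ≤ Module.finrank K (Submodule.span K (v '' Set.Iio k))
      + #{j ∈ range k | v j ∈ Submodule.span K (v '' Set.Iio j)} := by
  induction k with
  | zero => simp
  | succ k ih =>
    have hI : v '' Set.Iio (k + 1) = insert (v k) (v '' Set.Iio k) := by
      rw [← Set.image_insert_eq]
      congr 1
      ext j
      simp only [Set.mem_Iio, Set.mem_insert_iff]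
      omega
    rw [hI, Submodule.span_insert, range_add_one, filter_insert, sup_comm]
    split_ifs with h
    · rw [card_insert_of_notMem (by simp)]
      have : Module.finrank K (Submodule.span K (v '' Set.Iio k)) ≤
          Module.finrank K ↥(Submodule.span K (v '' Set.Iio k) ⊔ Submodule.span K {v k}) :=
        Submodule.finrank_mono le_sup_left
      omega
    · rw [Submodule.finrank_sup_span_singleton h]
      omega

/-- If `d + 1` vectors in dimension `d` lie in a common hyperplane, at least two of them are
dependent on their predecessors. -/
lemma exists_two_mem_span {K : Type*} [Field K] {d : ℕ} (v : Fin (d + 1) → Fin d → K)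
    (w : Fin d → K) (hw : w ≠ 0) (hv : ∀ j, ∑ i, w i * v j i = 0) :
    ∃ i i' : Fin (d + 1), i < i' ∧ v i ∈ Submodule.span K (v '' Set.Iio i) ∧
      v i' ∈ Submodule.span K (v '' Set.Iio i') ∧ Submodule.span K (v '' Set.Iio i') ≠ ⊤ := by
  classical
  let φ : (Fin d → K) →ₗ[K] K := ∑ i, w i • LinearMap.proj i
  have hφ : ∀ x, φ x = ∑ i, w i * x i := fun x => by simp [φ]
  have hφ0 : φ ≠ 0 := by
    intro h
    apply hw
    funext i
    have := hφ (Pi.single i 1)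
    rw [h] at this
    simpa [Pi.single_apply] using this.symm
  have hker : LinearMap.ker φ ≠ ⊤ := fun h => hφ0 (LinearMap.ker_eq_top.1 h)
  have hspan : ∀ s : Set (Fin (d + 1)), Submodule.span K (v '' s) ≤ LinearMap.ker φ := by
    intro s
    rw [Submodule.span_le]
    rintro _ ⟨j, _, rfl⟩
    simp [hφ, hv j]
  let u : ℕ → Fin d → K := fun j => if h : j < d + 1 then v ⟨j, h⟩ else 0
  have hu : ∀ j : Fin (d + 1), u j = v j := fun j => dif_pos j.2
  have himg : ∀ k : ℕ, k ≤ d + 1 → u '' Set.Iio k = v '' {j | (j : ℕ) < k} := by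
    intro k hk
    ext x
    constructor
    · rintro ⟨j, hj, rfl⟩
      exact ⟨⟨j, lt_of_lt_of_le hj hk⟩, hj, (hu ⟨j, lt_of_lt_of_le hj hk⟩).symm⟩
    · rintro ⟨j, hj, rfl⟩
      exact ⟨j, hj, hu j⟩
  have h1 := le_finrank_add_card_mem_span (K := K) u (d + 1)
  have h2 : Module.finrank K (Submodule.span K (u '' Set.Iio (d + 1))) < d := by
    rw [himg _ le_rfl]
    refine lt_of_le_of_lt (Submodule.finrank_mono (hspan _)) ?_
    have := Submodule.finrank_lt hker
    simpa using this
  have h3 : 1 < #{j ∈ range (d + 1) | u j ∈ Submodule.span K (u '' Set.Iio j)} := by omega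
  obtain ⟨a, ha, b, hb, hab⟩ := one_lt_card.1 h3
  have key : ∀ a ∈ ({j ∈ range (d + 1) | u j ∈ Submodule.span K (u '' Set.Iio j)} : Finset ℕ),
      ∃ i : Fin (d + 1), (i : ℕ) = a ∧ v i ∈ Submodule.span K (v '' Set.Iio i) := by
    intro a ha
    rw [mem_filter, mem_range] at ha
    refine ⟨⟨a, ha.1⟩, rfl, ?_⟩
    have := ha.2
    rw [himg a ha.1.le, show u a = v ⟨a, ha.1⟩ from hu ⟨a, ha.1⟩] at this
    exact this
  obtain ⟨i, hi, hi'⟩ := key a ha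
  obtain ⟨j, hj, hj'⟩ := key b hb
  have hne : ∀ s : Set (Fin (d + 1)), Submodule.span K (v '' s) ≠ ⊤ := fun s h =>
    hker (top_le_iff.1 (h ▸ hspan s))
  rcases lt_or_gt_of_ne hab with h | h
  · exact ⟨i, j, by rw [Fin.lt_def]; omega, hi', hj', hne _⟩
  · exact ⟨j, i, by rw [Fin.lt_def]; omega, hj', hi', hne _⟩

/-- The leading principal minor of order `i + 1` of the matrix `(β I | 0) + M T`. -/
def leadingMinor {d ℓ : ℕ} (M β : ℕ) (T : Fin (d + 1) → Fin d → Fin ℓ) (i : Fin d) : ℤ :=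
  Matrix.det (Matrix.of fun a b : Fin ((i : ℕ) + 1) =>
    gridCol M β (Fin.castLE i.2 b).castSucc (T (Fin.castLE i.2 b).castSucc) (Fin.castLE i.2 a))

lemma gridCol_castSucc {d ℓ : ℕ} (M β : ℕ) (j i : Fin d) (t : Fin d → Fin ℓ) :
    gridCol M β j.castSucc t i = (if j = i then (β : ℤ) else 0) + M * ((t i : ℕ) : ℤ) := by
  simp [gridCol, Fin.castSucc_inj]

lemma gridCol_nonneg {d ℓ : ℕ} (M β : ℕ) (j : Fin (d + 1)) (t : Fin d → Fin ℓ) (i : Fin d) :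
    0 ≤ gridCol M β j t i := by
  unfold gridCol; split_ifs <;> positivity

lemma gridCol_le_of_ne {d ℓ : ℕ} {M β : ℕ} {j : Fin (d + 1)} (t : Fin d → Fin ℓ) {i : Fin d}
    (h : j ≠ i.castSucc) : gridCol M β j t i ≤ M * ℓ := by
  unfold gridCol
  rw [if_neg h, zero_add]
  have := (t i).2.le
  gcongr

lemma gridCol_self {d ℓ : ℕ} {M β : ℕ} (t : Fin d → Fin ℓ) (i : Fin d) :
    (β : ℤ) ≤ gridCol M β i.castSucc t i ∧ gridCol M β i.castSucc t i ≤ β + M * ℓ := by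
  unfold gridCol
  rw [if_pos rfl]
  have := (t i).2.le
  constructor
  · have : (0 : ℤ) ≤ M * ((t i : ℕ) : ℤ) := by positivity
    linarith
  · gcongr

/-- The matrix is diagonally dominant. -/
lemma leadingMinor_ne_zero {d ℓ M β : ℕ} (h : d * (M * ℓ) < β) (T : Fin (d + 1) → Fin d → Fin ℓ)
    (i : Fin d) : leadingMinor M β T i ≠ 0 := by
  unfold leadingMinor
  intro h0
  set A : Matrix (Fin ((i : ℕ) + 1)) (Fin ((i : ℕ) + 1)) ℤ := Matrix.of fun a b =>
    gridCol M β (Fin.castLE i.2 b).castSucc (T (Fin.castLE i.2 b).castSucc)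
      (Fin.castLE i.2 a) with hA
  have h1 : (A.map (Int.castRingHom ℝ)).det ≠ 0 := by
    refine det_ne_zero_of_sum_row_lt_diag fun k => ?_
    have e1 : ∀ b ∈ univ.erase k, ‖A.map (Int.castRingHom ℝ) k b‖ ≤ ((M * ℓ : ℕ) : ℝ) := by
      intro b hb
      have hne : (Fin.castLE i.2 b).castSucc ≠ (Fin.castLE i.2 k).castSucc := by
        intro h
        exact ne_of_mem_erase hb (Fin.castLE_injective i.2 (Fin.castSucc_injective _ h))
      have := gridCol_le_of_ne (M := M) (β := β) (T (Fin.castLE i.2 b).castSucc) hne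
      have h0 := gridCol_nonneg M β (Fin.castLE i.2 b).castSucc (T (Fin.castLE i.2 b).castSucc)
        (Fin.castLE i.2 k)
      simp only [Matrix.map_apply, hA, Matrix.of_apply, eq_intCast, Real.norm_eq_abs]
      rw [abs_of_nonneg (by exact_mod_cast h0)]
      exact_mod_cast this
    have e2 : (β : ℝ) ≤ ‖A.map (Int.castRingHom ℝ) k k‖ := by
      have := (gridCol_self (M := M) (β := β) (T (Fin.castLE i.2 k).castSucc) (Fin.castLE i.2 k)).1
      simp only [Matrix.map_apply, hA, Matrix.of_apply, eq_intCast, Real.norm_eq_abs]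
      refine le_trans ?_ (le_abs_self _)
      exact_mod_cast this
    refine lt_of_le_of_lt (sum_le_card_nsmul _ _ _ e1) (lt_of_lt_of_le ?_ e2)
    rw [card_erase_of_mem (mem_univ _), card_univ, Fintype.card_fin, Nat.add_sub_cancel,
      nsmul_eq_mul]
    have : (i : ℕ) * (M * ℓ) < β := lt_of_le_of_lt (Nat.mul_le_mul_right _ i.2.le) h
    exact_mod_cast this
  rw [← RingHom.mapMatrix_apply, ← RingHom.map_det, h0] at h1
  simp at h1

lemma abs_sum_gridCol_le {d ℓ M β : ℕ} {ι : Type*} [Fintype ι] (f : ι → Fin d)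
    (hf : Function.Injective f) (T : Fin (d + 1) → Fin d → Fin ℓ) (i : Fin d) :
    ∑ b, |gridCol M β (f b).castSucc (T (f b).castSucc) i| ≤ β + d * (M * ℓ) := by
  have hsub : ∀ g : Fin d → ℤ, (∀ b, 0 ≤ g b) → ∑ b, g (f b) ≤ ∑ b, g b := by
    intro g hg
    rw [← sum_image (f := g) (s := univ) (g := f) hf.injOn]
    exact sum_le_univ_sum_of_nonneg hg
  calc ∑ b, |gridCol M β (f b).castSucc (T (f b).castSucc) i|
      ≤ ∑ b : Fin d, |gridCol M β b.castSucc (T b.castSucc) i| :=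
        hsub (fun b => |gridCol M β b.castSucc (T b.castSucc) i|) fun _ => abs_nonneg _
    _ ≤ ∑ b : Fin d, ((if b = i then (β : ℤ) else 0) + M * ℓ) := by
        refine sum_le_sum fun b _ => ?_
        rw [abs_of_nonneg (gridCol_nonneg _ _ _ _ _), gridCol_castSucc]
        have := (T b.castSucc i).2.le
        gcongr
    _ = β + d * (M * ℓ) := by
        rw [sum_add_distrib]; simp

lemma natAbs_leadingMinor_le {d ℓ M β : ℕ} (hβ : 1 ≤ β) (T : Fin (d + 1) → Fin d → Fin ℓ)
    (i : Fin d) : (leadingMinor M β T i).natAbs ≤ (β + d * (M * ℓ)) ^ d := by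
  have h1 : |leadingMinor M β T i| ≤ (β + d * (M * ℓ) : ℤ) ^ ((i : ℕ) + 1) := by
    refine (abs_det_le_prod_sum _).trans ?_
    calc _ ≤ ∏ _a : Fin ((i : ℕ) + 1), (β + d * (M * ℓ) : ℤ) :=
          prod_le_prod (fun _ _ => sum_nonneg fun _ _ => abs_nonneg _) fun a _ =>
            abs_sum_gridCol_le (Fin.castLE i.2) (Fin.castLE_injective i.2) T _
      _ = _ := by simp
  have h2 : ((leadingMinor M β T i).natAbs : ℤ) ≤ ((β + d * (M * ℓ) : ℕ) : ℤ) ^ ((i : ℕ) + 1) := by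
    rw [Int.natCast_natAbs]; exact_mod_cast h1
  refine le_trans (by exact_mod_cast h2) (Nat.pow_le_pow_right (by omega) i.2)

lemma dvd_leadingMinor {d ℓ M β p : ℕ} [Fact p.Prime] (T : Fin (d + 1) → Fin d → Fin ℓ) (i : Fin d)
    (h : (fun a => (gridCol M β i.castSucc (T i.castSucc) a : ZMod p)) ∈
      Submodule.span (ZMod p) ((fun j a => (gridCol M β j (T j) a : ZMod p)) '' Set.Iio i.castSucc)) :
    (p : ℤ) ∣ leadingMinor M β T i := by
  rw [← ZMod.intCast_zmod_eq_zero_iff_dvd, leadingMinor]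
  set A : Matrix (Fin ((i : ℕ) + 1)) (Fin ((i : ℕ) + 1)) ℤ := Matrix.of fun a b =>
    gridCol M β (Fin.castLE i.2 b).castSucc (T (Fin.castLE i.2 b).castSucc)
      (Fin.castLE i.2 a) with hA
  have h1 : ((A.det : ℤ) : ZMod p) = (A.map (Int.castRingHom (ZMod p))).det := by
    rw [← RingHom.mapMatrix_apply, ← RingHom.map_det]; rfl
  rw [h1]
  by_contra hdet
  have hli : LinearIndependent (ZMod p) (A.map (Int.castRingHom (ZMod p))).col := by
    rw [Matrix.linearIndependent_cols_iff_isUnit, Matrix.isUnit_iff_isUnit_det]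
    exact isUnit_iff_ne_zero.2 hdet
  refine hli.notMem_span_image (s := Set.Iio (Fin.last _)) (x := Fin.last _) (by simp) ?_
  let π : (Fin d → ZMod p) →ₗ[ZMod p] (Fin ((i : ℕ) + 1) → ZMod p) :=
    LinearMap.funLeft (ZMod p) (ZMod p) (Fin.castLE i.2)
  have h2 := Submodule.mem_map_of_mem (f := π) h
  rw [Submodule.map_span, ← Set.image_comp] at h2
  have e1 : (A.map (Int.castRingHom (ZMod p))).col (Fin.last _) =
      π (fun a => (gridCol M β i.castSucc (T i.castSucc) a : ZMod p)) := by
    funext a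
    simp [π, hA, LinearMap.funLeft_apply, Matrix.col]
    rfl
  rw [e1]
  refine Submodule.span_mono ?_ h2
  rintro _ ⟨j, hj, rfl⟩
  have hj' : (j : ℕ) < i := hj
  refine ⟨⟨j, by omega⟩, ?_, ?_⟩
  · exact hj'
  · funext a
    simp [π, hA, LinearMap.funLeft_apply, Matrix.col]

/-! ### Primitive matrices have positive density -/

/-- The columns of `(β I | 0) + M T` modulo `p`. -/
def gridColMod {d ℓ : ℕ} (M β p : ℕ) (T : Fin (d + 1) → Fin d → Fin ℓ) (j : Fin (d + 1)) :
    Fin d → ZMod p :=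
  fun i => (gridCol M β j (T j) i : ZMod p)

open Classical in
lemma card_mem_subspace_le {d ℓ M β p : ℕ} [Fact p.Prime] (hM : ¬ p ∣ M) (hp : ℓ < p)
    (j : Fin (d + 1)) (V : Submodule (ZMod p) (Fin d → ZMod p)) :
    #{t : Fin d → Fin ℓ | V ≠ ⊤ ∧ (fun i => (gridCol M β j t i : ZMod p)) ∈ V} ≤ ℓ ^ (d - 1) := by
  by_cases hV : V = ⊤
  · simp [hV]
  obtain ⟨φ, hφ, hle⟩ := Submodule.exists_le_ker_of_lt_top V (lt_top_iff_ne_top.2 hV)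
  have hM' : (M : ZMod p) ≠ 0 := fun h => hM ((ZMod.natCast_eq_zero_iff _ _).1 h)
  let w : Fin d → ZMod p := fun i => φ fun k => if i = k then 1 else 0
  have hw : ∀ x, φ x = ∑ i, w i * x i := fun x => by
    rw [LinearMap.pi_apply_eq_sum_univ φ x]
    exact sum_congr rfl fun i _ => by rw [smul_eq_mul, mul_comm]
  obtain ⟨i₀, hi₀⟩ : ∃ i₀, w i₀ ≠ 0 := by
    by_contra! h
    exact hφ (LinearMap.ext fun x => by rw [hw]; simp [h])
  have := card_hyperplane_le ℓ hM' (fun i => if j = i.castSucc then (β : ZMod p) else 0) w hi₀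
  rw [Nat.div_eq_of_lt hp, zero_add, one_mul] at this
  refine le_trans (card_le_card ?_) this
  intro t ht
  simp only [mem_filter, mem_univ, true_and] at ht ⊢
  have h2 := hle ht.2
  rw [LinearMap.mem_ker, hw] at h2
  refine Eq.trans (sum_congr rfl fun i _ => ?_) h2
  simp [gridCol]

lemma leadingMinor_update {d ℓ M β : ℕ} (T : Fin (d + 1) → Fin d → Fin ℓ) (i : Fin d)
    {j : Fin (d + 1)} (h : i.castSucc < j) (t : Fin d → Fin ℓ) :
    leadingMinor M β (Function.update T j t) i = leadingMinor M β T i := by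
  unfold leadingMinor
  congr 1
  funext a b
  have : (Fin.castLE i.2 b).castSucc ≠ j := by
    refine ne_of_lt (lt_of_le_of_lt ?_ h)
    rw [Fin.le_def]
    simpa using Nat.le_of_lt_succ b.2
  simp only [Matrix.of_apply, Function.update_of_ne this]

open Classical in
/-- Fix all columns but the `j`-th one. The possible primes are large divisors of nonzero minors of
the preceding columns, so that there are few of them, and for each one the `j`-th column is confined
to a given proper subspace. -/
lemma card_dependent_mod_large_prime_le {d ℓ M β : ℕ} (hℓ : 2 ≤ ℓ) (hM0 : 0 < M) (hM : M ≤ ℓ)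
    (h : d * (M * ℓ) < β) (hβ : β + d * (M * ℓ) ≤ ℓ ^ 2) (j : Fin (d + 1)) :
    #{T : Fin (d + 1) → Fin d → Fin ℓ | ∃ p : ℕ, p.Prime ∧ ℓ < p ∧
        (∃ i : Fin d, i.castSucc < j ∧ (p : ℤ) ∣ leadingMinor M β T i) ∧
        Submodule.span (ZMod p) (gridColMod M β p T '' Set.Iio j) ≠ ⊤ ∧
        gridColMod M β p T j ∈ Submodule.span (ZMod p) (gridColMod M β p T '' Set.Iio j)}
      ≤ (d * (2 * d)) * ℓ ^ (d - 1) * (ℓ ^ d) ^ d := by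
  have := card_le_of_update j ({T : Fin (d + 1) → Fin d → Fin ℓ | ∃ p : ℕ, p.Prime ∧ ℓ < p ∧
        (∃ i : Fin d, i.castSucc < j ∧ (p : ℤ) ∣ leadingMinor M β T i) ∧
        Submodule.span (ZMod p) (gridColMod M β p T '' Set.Iio j) ≠ ⊤ ∧
        gridColMod M β p T j ∈ Submodule.span (ZMod p) (gridColMod M β p T '' Set.Iio j)} : Finset _)
      ((d * (2 * d)) * ℓ ^ (d - 1)) ?_
  · simpa using this
  intro g
  -- the primes in question depend only on the columns before the `j`-th one
  let P : Finset ℕ := univ.biUnion fun i : Fin d =>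
    {p ∈ (leadingMinor M β g i).natAbs.primeFactors | ℓ < p}
  have hP : #P ≤ d * (2 * d) := by
    refine (card_biUnion_le_card_mul _ _ (2 * d) fun i _ => ?_).trans (by simp)
    refine card_large_primeFactors_le hℓ (Int.natAbs_ne_zero.2 (leadingMinor_ne_zero h g i)) ?_
    refine (natAbs_leadingMinor_le (by omega) g i).trans ?_
    rw [pow_mul]
    exact Nat.pow_le_pow_left hβ d
  let V : (p : ℕ) → Submodule (ZMod p) (Fin d → ZMod p) := fun p =>
    Submodule.span (ZMod p) (gridColMod M β p g '' Set.Iio j)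
  have hVx : ∀ p x, Submodule.span (ZMod p)
      (gridColMod M β p (Function.update g j x) '' Set.Iio j) = V p := by
    intro p x
    congr 1
    refine Set.image_congr fun i hi => ?_
    have hi' : i ≠ j := ne_of_lt (Set.mem_Iio.1 hi)
    funext k
    simp only [gridColMod, Function.update_of_ne hi']
  refine le_trans (card_le_card (t := P.biUnion fun p =>
    {t : Fin d → Fin ℓ | V p ≠ ⊤ ∧ (fun i => (gridCol M β j t i : ZMod p)) ∈ V p}) ?_) ?_
  · intro x hx
    simp only [mem_filter, mem_univ, true_and] at hx
    obtain ⟨p, hp, hlp, ⟨i, hij, hdvd⟩, h1, h2⟩ := hx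
    rw [hVx] at h1 h2
    rw [leadingMinor_update g i hij] at hdvd
    simp only [mem_biUnion, mem_filter, mem_univ, true_and, P]
    refine ⟨p, ⟨i, ?_, hlp⟩, h1, ?_⟩
    · exact Nat.mem_primeFactors.2 ⟨hp, Int.natCast_dvd.1 hdvd,
        Int.natAbs_ne_zero.2 (leadingMinor_ne_zero h g i)⟩
    · unfold gridColMod at h2
      rw [Function.update_self] at h2
      exact h2
  · refine (card_biUnion_le_card_mul _ _ (ℓ ^ (d - 1)) fun p hp => ?_).trans
      (Nat.mul_le_mul_right _ hP)
    simp only [mem_biUnion, mem_filter, mem_univ, true_and, P] at hp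
    obtain ⟨i, hpi, hlp⟩ := hp
    have : Fact p.Prime := ⟨Nat.prime_of_mem_primeFactors hpi⟩
    exact card_mem_subspace_le (fun hd => absurd (Nat.le_of_dvd hM0 hd) (by omega)) hlp j (V p)

/-- The matrix `(β I | 0) + M T` is primitive: its `d` rows form a basis of a saturated sublattice
of `ℤ ^ (d + 1)`. -/
def Primitive {d ℓ : ℕ} (M β : ℕ) (T : Fin (d + 1) → Fin d → Fin ℓ) : Prop :=
  ∀ p : ℕ, p.Prime → PrimitiveAt M β T p

open Classical in
/-- For a suitable modulus `M`, at least half of the matrices `(β I | 0) + M T` are primitive. The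
congruence takes care of the small primes; primes up to `ℓ` are handled by a union bound over the
possible row relations. A larger prime at which primitivity fails has two columns dependent on
their predecessors: the first one confines the prime to the few large divisors of a leading
principal minor, the second one then lies in a given proper subspace. -/
theorem exists_primitive_card_ge (d : ℕ) (hd : 1 ≤ d) :
    ∃ M : ℕ, 0 < M ∧ ∃ ℓ₀ : ℕ, ∀ ℓ ≥ ℓ₀, ∀ β : ℕ, β ≡ 1 [MOD M] → d * (M * ℓ) < β →
      β + d * (M * ℓ) ≤ ℓ ^ 2 →
      (ℓ : ℝ) ^ (d * (d + 1)) ≤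
        2 * #{T : Fin (d + 1) → Fin d → Fin ℓ | Primitive M β T} := by
  set P₀ : ℕ := d * 2 ^ (d + 3) with hP₀
  have hP₀pos : 0 < P₀ := by positivity
  refine ⟨P₀.factorial, Nat.factorial_pos _,
    max 2 (max P₀.factorial (8 * (d * d * (d + 1)))), fun ℓ hℓ β hβ1 hβ2 hβ3 => ?_⟩
  set M := P₀.factorial with hMdef
  have hℓ2 : 2 ≤ ℓ := le_trans (le_max_left _ _) hℓ
  have hℓM : M ≤ ℓ := le_trans ((le_max_left _ _).trans (le_max_right _ _)) hℓ
  have hℓd : 8 * (d * d * (d + 1)) ≤ ℓ := le_trans ((le_max_right _ _).trans (le_max_right _ _)) hℓ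
  have hℓP : P₀ ≤ ℓ := (Nat.self_le_factorial _).trans hℓM
  -- failures of primitivity at primes up to `ℓ`
  set A : Finset (Fin (d + 1) → Fin d → Fin ℓ) :=
    {p ∈ Ioc P₀ ℓ | p.Prime}.biUnion fun p => {T | ¬ PrimitiveAt M β T p} with hA
  -- failures of primitivity at primes above `ℓ`
  set C : Finset (Fin (d + 1) → Fin d → Fin ℓ) := univ.biUnion fun j : Fin (d + 1) =>
    {T : Fin (d + 1) → Fin d → Fin ℓ | ∃ p : ℕ, p.Prime ∧ ℓ < p ∧
        (∃ i : Fin d, i.castSucc < j ∧ (p : ℤ) ∣ leadingMinor M β T i) ∧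
        Submodule.span (ZMod p) (gridColMod M β p T '' Set.Iio j) ≠ ⊤ ∧
        gridColMod M β p T j ∈ Submodule.span (ZMod p) (gridColMod M β p T '' Set.Iio j)} with hC
  have hcover : (univ : Finset (Fin (d + 1) → Fin d → Fin ℓ)) ⊆
      ({T : Fin (d + 1) → Fin d → Fin ℓ | Primitive M β T} : Finset _) ∪ (A ∪ C) := by
    intro T _
    by_cases hT : Primitive M β T
    · simp [hT]
    rw [mem_union, mem_union]
    right
    simp only [Primitive, not_forall] at hT
    obtain ⟨p, hp, hpT⟩ := hT
    have : Fact p.Prime := ⟨hp⟩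
    rcases le_or_gt p P₀ with h1 | h1
    · exact absurd (primitiveAt_of_dvd T (Nat.dvd_factorial hp.pos h1) hβ1) hpT
    rcases le_or_gt p ℓ with h2 | h2
    · left
      simp only [hA, mem_biUnion, mem_filter, mem_univ, true_and, mem_Ioc]
      exact ⟨p, ⟨⟨h1, h2⟩, hp⟩, hpT⟩
    · right
      simp only [PrimitiveAt, not_forall] at hpT
      obtain ⟨w, hw, hne⟩ := hpT
      obtain ⟨i, i', hii', h3, h4, h5⟩ := exists_two_mem_span (gridColMod M β p T) w hne hw
      simp only [hC, mem_biUnion, mem_filter, mem_univ, true_and]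
      obtain ⟨k, rfl⟩ : ∃ k : Fin d, k.castSucc = i :=
        ⟨i.castPred (Fin.ne_last_of_lt hii'), Fin.castSucc_castPred _ _⟩
      exact ⟨i', p, hp, h2, ⟨k, hii', dvd_leadingMinor T k h3⟩, h5, h4⟩
  set N : ℝ := (ℓ : ℝ) ^ (d * (d + 1)) with hN
  have hcardT : (#(univ : Finset (Fin (d + 1) → Fin d → Fin ℓ)) : ℝ) = N := by
    rw [card_univ]
    simp [hN, pow_mul]
  have hℓR : (0 : ℝ) < ℓ := by exact_mod_cast (by omega : 0 < ℓ)
  have hNpos : 0 < N := by positivity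
  have hP₀R : (0 : ℝ) < P₀ := by exact_mod_cast hP₀pos
  have hAcard : (#A : ℝ) ≤ N / 4 := by
    calc (#A : ℝ) ≤ ∑ p ∈ Ioc P₀ ℓ with p.Prime,
          (#{T : Fin (d + 1) → Fin d → Fin ℓ | ¬ PrimitiveAt M β T p} : ℝ) := by
          exact_mod_cast card_biUnion_le
      _ ≤ ∑ p ∈ Ioc P₀ ℓ with p.Prime, d * 2 ^ (d + 1) * ((p : ℝ) ^ 2)⁻¹ * N := by
          refine sum_le_sum fun p hp => ?_
          rw [mem_filter, mem_Ioc] at hp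
          have : Fact p.Prime := ⟨hp.2⟩
          exact card_not_primitiveAt_le
            (fun h => absurd ((Nat.Prime.dvd_factorial hp.2).1 h) (by omega)) hp.1.2 hd
      _ ≤ ∑ p ∈ Ioc P₀ ℓ, d * 2 ^ (d + 1) * ((p : ℝ) ^ 2)⁻¹ * N :=
          sum_le_sum_of_subset_of_nonneg (filter_subset _ _) fun _ _ _ => by positivity
      _ = d * 2 ^ (d + 1) * (∑ p ∈ Ioc P₀ ℓ, ((p : ℝ) ^ 2)⁻¹) * N := by
          rw [mul_sum, sum_mul]
      _ ≤ d * 2 ^ (d + 1) * (P₀ : ℝ)⁻¹ * N := by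
          have := sum_Ioc_inv_sq_le_sub (α := ℝ) hP₀pos.ne' hℓP
          have h2 : (0 : ℝ) ≤ (ℓ : ℝ)⁻¹ := by positivity
          gcongr
          linarith
      _ = N / 4 := by
          have : (P₀ : ℝ) = d * 2 ^ (d + 1) * 4 := by rw [hP₀]; push_cast; ring
          have hdR : (0 : ℝ) < d := by exact_mod_cast hd
          rw [this]
          field_simp
  have hCcard : (#C : ℝ) ≤ N / 4 := by
    have h1 : #C ≤ (d + 1) * ((d * (2 * d)) * ℓ ^ (d - 1) * (ℓ ^ d) ^ d) := by
      refine (card_biUnion_le_card_mul _ _ _ fun j _ =>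
        card_dependent_mod_large_prime_le hℓ2 (Nat.factorial_pos _) hℓM hβ2 hβ3 j).trans ?_
      simp
    have h2 : 4 * ((d + 1) * ((d * (2 * d)) * ℓ ^ (d - 1) * (ℓ ^ d) ^ d)) ≤ ℓ ^ (d * (d + 1)) := by
      have e1 : ℓ ^ (d * (d + 1)) = ℓ * (ℓ ^ (d - 1) * (ℓ ^ d) ^ d) := by
        obtain ⟨e, rfl⟩ : ∃ e, d = e + 1 := ⟨d - 1, by omega⟩
        rw [Nat.add_sub_cancel]; ring
      rw [e1]
      calc _ = (8 * (d * d * (d + 1))) * (ℓ ^ (d - 1) * (ℓ ^ d) ^ d) := by ring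
        _ ≤ _ := Nat.mul_le_mul_right _ hℓd
    have h3 : 4 * (#C : ℝ) ≤ N := by
      rw [hN]
      exact_mod_cast (Nat.mul_le_mul_left 4 h1).trans h2
    linarith
  have hfin : N ≤ #{T : Fin (d + 1) → Fin d → Fin ℓ | Primitive M β T} + (#A + #C) := by
    rw [← hcardT]
    have := (card_le_card hcover).trans ((card_union_le _ _).trans
      (Nat.add_le_add_left (card_union_le _ _) _))
    exact_mod_cast this
  linarith

end Folklore

namespace Folklore

open Finset MeasureTheory

/-! ### Points without short almost relations -/

/-- The points `θ` at which no integer vector `b ≠ 0` with `|bᵢ| < r` makes `b · θ` closer than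
`c / r ^ d` to an integer. -/
def AvoidSet (d r : ℕ) (c : ℝ) : Set (Fin d → ℝ) :=
  {θ | ∀ b : Fin d → ℤ, b ≠ 0 → (∀ i, |b i| < (r : ℤ)) → ∀ m : ℤ,
    c / (r : ℝ) ^ d ≤ |∑ i, (b i : ℝ) * θ i + m|}

/-- In a lattice with a primitive system of generators, an integer vector which is a rational
combination of the generators with all coefficients less than `1` in absolute value vanishes. -/
lemma eq_zero_of_primitive_of_abs_lt {d : ℕ} (B : Fin d → Fin d → ℤ) (m : Fin d → ℤ)
    (hprim : ∀ p : ℕ, p.Prime → ∀ w : Fin d → ZMod p,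
      (∀ j, ∑ i, w i * (B i j : ZMod p) = 0) → ∑ i, w i * (m i : ZMod p) = 0 → w = 0)
    (b : Fin d → ℤ) (m₀ : ℤ) (k : ℕ) : 0 < k → ∀ y : Fin d → ℤ, (∀ i, |y i| < (k : ℤ)) →
      (∀ j, ∑ i, y i * B i j = k * b j) → ∑ i, y i * m i = k * m₀ → b = 0 := by
  induction k using Nat.strong_induction_on with
  | _ k ih =>
    intro hk y hy hB hm
    by_cases h1 : k = 1
    · funext j
      have h0 : ∀ i, y i = 0 := fun i => by
        have := hy i
        rw [h1] at this
        exact Int.abs_lt_one_iff.1 (by exact_mod_cast this)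
      have := hB j
      simp only [h0, zero_mul, sum_const_zero, h1] at this
      simpa using this.symm
    · -- a prime factor of `k` divides all coefficients and can be cancelled
      obtain ⟨p, hp, q, rfl⟩ := Nat.exists_prime_and_dvd h1
      have hw := hprim p hp (fun i => (y i : ZMod p)) (fun j => ?_) ?_
      rotate_left
      · have := congrArg (Int.cast : ℤ → ZMod p) (hB j)
        push_cast at this
        simpa using this
      · have := congrArg (Int.cast : ℤ → ZMod p) hm
        push_cast at this
        simpa using this
      have hdvd : ∀ i, (p : ℤ) ∣ y i := fun i =>
        (ZMod.intCast_zmod_eq_zero_iff_dvd (y i) p).1 (congrFun hw i)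
      choose z hz using hdvd
      have hp0 : (0 : ℤ) < p := by exact_mod_cast hp.pos
      have hq : 0 < q := Nat.pos_of_mul_pos_left hk
      refine ih q ?_ hq z ?_ ?_ ?_
      · exact lt_mul_of_one_lt_left hq hp.one_lt
      · intro i
        have := hy i
        rw [hz i, abs_mul, abs_of_pos hp0] at this
        push_cast at this
        exact lt_of_mul_lt_mul_left this hp0.le
      · intro j
        refine mul_left_cancel₀ hp0.ne' ?_
        rw [mul_sum]
        have := hB j
        push_cast at this
        rw [← mul_assoc, ← this]
        exact sum_congr rfl fun i _ => by rw [hz i]; ring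
      · refine mul_left_cancel₀ hp0.ne' ?_
        rw [mul_sum]
        push_cast at hm
        rw [← mul_assoc, ← hm]
        exact sum_congr rfl fun i _ => by rw [hz i]; ring

/-- If the rows of a primitive system `(B | m)` are almost relations of `θ` and the matrix `B` is
close enough to a multiple of the identity, then `θ` has no other short almost relation: by
integrality, such a relation would be a combination of the rows with coefficients less than `1`. -/
lemma mem_avoidSet_of_primitive {d r : ℕ} (hr : 0 < r) {c ε : ℝ}
    (B : Matrix (Fin d) (Fin d) ℤ) (m : Fin d → ℤ)
    (hprim : ∀ p : ℕ, p.Prime → ∀ w : Fin d → ZMod p,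
      (∀ j, ∑ i, w i * (B i j : ZMod p) = 0) → ∑ i, w i * (m i : ZMod p) = 0 → w = 0)
    (hcol : ∀ j, (r : ℤ) + ∑ i ∈ univ.erase j, |B i j| ≤ B j j) (hD0 : B.det ≠ 0)
    (hdet : |(B.det : ℝ)| * (c + d * ε) < (r : ℝ) ^ d)
    (θ : Fin d → ℝ) (hθ : ∀ i, |∑ j, (B i j : ℝ) * θ j + m i| ≤ ε / (r : ℝ) ^ d) :
    θ ∈ AvoidSet d r c := by
  intro b hb hbr m₀
  by_contra! hlt
  have hrR : (0 : ℝ) < r := by exact_mod_cast hr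
  have hrd : (0 : ℝ) < (r : ℝ) ^ d := by positivity
  set D := B.det with hD
  -- Cramer's rule: `y / D` are the coefficients of `b` in terms of the rows of `B`
  set y : Fin d → ℤ := Matrix.vecMul b B.adjugate with hy
  have hyB : ∀ j, ∑ i, y i * B i j = D * b j := by
    intro j
    have : Matrix.vecMul y B = D • b := by
      rw [hy, Matrix.vecMul_vecMul, Matrix.adjugate_mul, Matrix.vecMul_smul, Matrix.vecMul_one]
    have := congrFun this j
    simpa [Matrix.vecMul, dotProduct] using this
  have hDpos : 0 < |D| := abs_pos.2 hD0
  -- the coefficients `y i / D` are smaller than `1` because the columns are diagonally dominant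
  have hylt : ∀ i, |y i| < |D| := by
    intro i
    obtain ⟨j, -, hj⟩ := exists_max_image univ (fun i => |y i|) ⟨i, mem_univ i⟩
    refine lt_of_le_of_lt (hj i (mem_univ i)) ?_
    have h1 : |y j| * B j j ≤ |D| * |b j| + |y j| * ∑ i ∈ univ.erase j, |B i j| := by
      have e : y j * B j j = D * b j - ∑ i ∈ univ.erase j, y i * B i j := by
        rw [← hyB j, ← add_sum_erase _ _ (mem_univ j)]; ring
      calc |y j| * B j j ≤ |y j * B j j| := by
            rw [abs_mul]; exact mul_le_mul_of_nonneg_left (le_abs_self _) (abs_nonneg _)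
        _ ≤ |D * b j| + |∑ i ∈ univ.erase j, y i * B i j| := by rw [e]; exact abs_sub _ _
        _ ≤ |D| * |b j| + ∑ i ∈ univ.erase j, |y j| * |B i j| := by
            rw [abs_mul]
            gcongr
            refine (abs_sum_le_sum_abs _ _).trans (sum_le_sum fun i _ => ?_)
            rw [abs_mul]
            exact mul_le_mul_of_nonneg_right (hj i (mem_univ i)) (abs_nonneg _)
        _ = _ := by rw [mul_sum]
    have h2 : |y j| * r ≤ |D| * |b j| := by
      have := mul_le_mul_of_nonneg_left (hcol j) (abs_nonneg (y j))
      rw [mul_add] at this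
      linarith
    have h3 : |D| * |b j| < |D| * r := mul_lt_mul_of_pos_left (hbr j) hDpos
    have hr' : (0 : ℤ) < r := by exact_mod_cast hr
    exact lt_of_mul_lt_mul_right (h2.trans_lt h3) hr'.le
  -- an integer which is too small not to vanish
  have hm0 : ∑ i, y i * m i = D * m₀ := by
    have hlt1 : |((D * m₀ - ∑ i, y i * m i : ℤ) : ℝ)| < 1 := by
      have e : ((D * m₀ - ∑ i, y i * m i : ℤ) : ℝ)
          = D * (∑ i, (b i : ℝ) * θ i + m₀) - ∑ i, y i * (∑ j, (B i j : ℝ) * θ j + m i) := by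
        have e1 : ∑ i, (y i : ℝ) * ∑ j, (B i j : ℝ) * θ j = D * ∑ j, (b j : ℝ) * θ j := by
          simp only [mul_sum]
          rw [sum_comm]
          refine sum_congr rfl fun j _ => ?_
          have := congrArg (Int.cast : ℤ → ℝ) (hyB j)
          push_cast at this
          rw [← mul_assoc, ← this, sum_mul]
          exact sum_congr rfl fun i _ => by ring
        push_cast
        simp only [mul_add, sum_add_distrib, e1]
        ring
      rw [e]
      have hDR : (0 : ℝ) < |(D : ℝ)| := by exact_mod_cast hDpos
      calc _ ≤ |(D : ℝ) * (∑ i, (b i : ℝ) * θ i + m₀)| +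
            |∑ i, (y i : ℝ) * (∑ j, (B i j : ℝ) * θ j + m i)| := abs_sub _ _
        _ ≤ |(D : ℝ)| * |∑ i, (b i : ℝ) * θ i + m₀| +
            ∑ _i : Fin d, |(D : ℝ)| * (ε / (r : ℝ) ^ d) := by
            rw [abs_mul]
            gcongr
            refine (abs_sum_le_sum_abs _ _).trans (sum_le_sum fun i _ => ?_)
            rw [abs_mul]
            have : |(y i : ℝ)| ≤ |(D : ℝ)| := by exact_mod_cast (hylt i).le
            exact mul_le_mul this (hθ i) (abs_nonneg _) hDR.le
        _ < |(D : ℝ)| * (c / (r : ℝ) ^ d) + ∑ _i : Fin d, |(D : ℝ)| * (ε / (r : ℝ) ^ d) := by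
            gcongr
        _ = |(D : ℝ)| * (c + d * ε) / (r : ℝ) ^ d := by
            simp only [sum_const, card_univ, Fintype.card_fin, nsmul_eq_mul]
            field_simp
        _ < 1 := by rwa [div_lt_one hrd]
    have : D * m₀ - ∑ i, y i * m i = 0 := Int.abs_lt_one_iff.1 (by exact_mod_cast hlt1)
    linarith
  have hs : D.sign * D = D.natAbs := by rw [Int.sign_mul_self_eq_abs, Int.natCast_natAbs]
  refine hb (eq_zero_of_primitive_of_abs_lt B m hprim b m₀ D.natAbs
    (Int.natAbs_pos.2 hD0) (fun i => D.sign * y i) (fun i => ?_) (fun j => ?_) ?_)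
  · rw [abs_mul, Int.natCast_natAbs, Int.abs_sign_of_ne_zero hD0, one_mul]
    exact hylt i
  · rw [← hs, mul_assoc, ← hyB j, mul_sum]
    exact sum_congr rfl fun i _ => by ring
  · rw [← hs, mul_assoc, ← hm0, mul_sum]
    exact sum_congr rfl fun i _ => by ring

/-! ### The volume of the set of points without short almost relations -/

/-- The square part of the matrix `(β I | 0) + M T`. -/
def gridMatrix {d ℓ : ℕ} (M β : ℕ) (T : Fin (d + 1) → Fin d → Fin ℓ) : Matrix (Fin d) (Fin d) ℤ :=
  Matrix.of fun i j => gridCol M β j.castSucc (T j.castSucc) i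

/-- The last column of the matrix `(β I | 0) + M T`. -/
def gridLast {d ℓ : ℕ} (M β : ℕ) (T : Fin (d + 1) → Fin d → Fin ℓ) (i : Fin d) : ℤ :=
  gridCol M β (Fin.last d) (T (Fin.last d)) i

lemma gridMatrix_nonneg {d ℓ : ℕ} (M β : ℕ) (T : Fin (d + 1) → Fin d → Fin ℓ) (i j : Fin d) :
    0 ≤ gridMatrix M β T i j := gridCol_nonneg _ _ _ _ _

lemma gridMatrix_le_of_ne {d ℓ : ℕ} (M β : ℕ) (T : Fin (d + 1) → Fin d → Fin ℓ) {i j : Fin d}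
    (h : j ≠ i) : gridMatrix M β T i j ≤ M * ℓ :=
  gridCol_le_of_ne _ fun e => h (Fin.castSucc_injective _ e)

lemma gridMatrix_diag {d ℓ : ℕ} (M β : ℕ) (T : Fin (d + 1) → Fin d → Fin ℓ) (i : Fin d) :
    (β : ℤ) ≤ gridMatrix M β T i i := (gridCol_self _ _).1

lemma gridLast_nonneg {d ℓ : ℕ} (M β : ℕ) (T : Fin (d + 1) → Fin d → Fin ℓ) (i : Fin d) :
    0 ≤ gridLast M β T i := gridCol_nonneg _ _ _ _ _

lemma gridLast_le {d ℓ : ℕ} (M β : ℕ) (T : Fin (d + 1) → Fin d → Fin ℓ) (i : Fin d) :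
    gridLast M β T i ≤ M * ℓ :=
  gridCol_le_of_ne _ (Fin.castSucc_lt_last i).ne'

lemma sum_erase_abs_col_le {d ℓ : ℕ} (M β : ℕ) (T : Fin (d + 1) → Fin d → Fin ℓ) (j : Fin d) :
    ∑ i ∈ univ.erase j, |gridMatrix M β T i j| ≤ d * (M * ℓ) := by
  calc _ ≤ ∑ _i ∈ univ.erase j, (M * ℓ : ℤ) := by
        refine sum_le_sum fun i hi => ?_
        rw [abs_of_nonneg (gridMatrix_nonneg _ _ _ _ _)]
        exact gridMatrix_le_of_ne _ _ _ (ne_of_mem_erase hi).symm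
    _ ≤ ∑ _i : Fin d, (M * ℓ : ℤ) := sum_le_univ_sum_of_nonneg fun _ => by positivity
    _ = _ := by simp

lemma sum_erase_abs_row_le {d ℓ : ℕ} (M β : ℕ) (T : Fin (d + 1) → Fin d → Fin ℓ) (i : Fin d) :
    ∑ j ∈ univ.erase i, |gridMatrix M β T i j| ≤ d * (M * ℓ) := by
  calc _ ≤ ∑ _i ∈ univ.erase i, (M * ℓ : ℤ) := by
        refine sum_le_sum fun j hj => ?_
        rw [abs_of_nonneg (gridMatrix_nonneg _ _ _ _ _)]
        exact gridMatrix_le_of_ne _ _ _ (ne_of_mem_erase hj)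
    _ ≤ ∑ _i : Fin d, (M * ℓ : ℤ) := sum_le_univ_sum_of_nonneg fun _ => by positivity
    _ = _ := by simp

lemma det_gridMatrix_map_ne_zero {d ℓ M β : ℕ} (h : d * (M * ℓ) < β)
    (T : Fin (d + 1) → Fin d → Fin ℓ) :
    ((gridMatrix M β T).map (Int.castRingHom ℝ)).det ≠ 0 := by
  refine det_ne_zero_of_sum_row_lt_diag fun i => ?_
  have h1 := sum_erase_abs_row_le M β T i
  have h2 := gridMatrix_diag M β T i
  have h3 : ∑ j ∈ univ.erase i, |gridMatrix M β T i j| < |gridMatrix M β T i i| := by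
    refine lt_of_le_of_lt h1 (lt_of_lt_of_le ?_ (h2.trans (le_abs_self _)))
    exact_mod_cast h
  simp only [Matrix.map_apply, eq_intCast, Real.norm_eq_abs]
  exact_mod_cast h3

lemma det_gridMatrix_ne_zero {d ℓ M β : ℕ} (h : d * (M * ℓ) < β)
    (T : Fin (d + 1) → Fin d → Fin ℓ) : (gridMatrix M β T).det ≠ 0 := by
  intro h0
  have := det_gridMatrix_map_ne_zero h T
  rw [← RingHom.mapMatrix_apply, ← RingHom.map_det, h0] at this
  simp at this

lemma sum_abs_gridMatrix_le {d ℓ : ℕ} (M β : ℕ) (T : Fin (d + 1) → Fin d → Fin ℓ) (i : Fin d) :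
    ∑ j, |gridMatrix M β T i j| ≤ β + d * (M * ℓ) :=
  abs_sum_gridCol_le id Function.injective_id T i

lemma abs_det_gridMatrix_le {d ℓ : ℕ} (M β : ℕ) (T : Fin (d + 1) → Fin d → Fin ℓ) :
    |(gridMatrix M β T).det| ≤ (β + d * (M * ℓ) : ℤ) ^ d := by
  refine (abs_det_le_prod_sum _).trans ?_
  calc _ ≤ ∏ _i : Fin d, (β + d * (M * ℓ) : ℤ) :=
        prod_le_prod (fun _ _ => sum_nonneg fun _ _ => abs_nonneg _)
          fun i _ => sum_abs_gridMatrix_le M β T i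
    _ = _ := by simp

/-- The point at which all rows of `(β I | 0) + M T` are exact relations is small. -/
lemma exists_center {d ℓ M β r : ℕ} (hr : 0 < r) (h : r + d * (M * ℓ) < β) (hMr : 4 * (M * ℓ) ≤ r)
    (T : Fin (d + 1) → Fin d → Fin ℓ) :
    ∃ θ₀ : Fin d → ℝ, (∀ i, |θ₀ i| ≤ 1 / 4) ∧
      ∀ i, ∑ j, (gridMatrix M β T i j : ℝ) * θ₀ j + gridLast M β T i = 0 := by
  set A := (gridMatrix M β T).map (Int.castRingHom ℝ) with hA
  have hdet : IsUnit A.det := isUnit_iff_ne_zero.2 (det_gridMatrix_map_ne_zero (by omega) T)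
  set θ₀ : Fin d → ℝ := A⁻¹.mulVec fun i => -(gridLast M β T i : ℝ) with hθ₀
  have hrel : ∀ i, ∑ j, (gridMatrix M β T i j : ℝ) * θ₀ j = -(gridLast M β T i : ℝ) := by
    intro i
    have : A.mulVec θ₀ = fun i => -(gridLast M β T i : ℝ) := by
      rw [hθ₀, Matrix.mulVec_mulVec, Matrix.mul_nonsing_inv _ hdet, Matrix.one_mulVec]
    have := congrFun this i
    simpa [Matrix.mulVec, dotProduct, hA] using this
  refine ⟨θ₀, fun i => ?_, fun i => by rw [hrel]; ring⟩
  obtain ⟨j, -, hj⟩ := exists_max_image univ (fun i => |θ₀ i|) ⟨i, mem_univ i⟩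
  refine (hj i (mem_univ i)).trans ?_
  have e : (gridMatrix M β T j j : ℝ) * θ₀ j =
      -(gridLast M β T j : ℝ) - ∑ k ∈ univ.erase j, (gridMatrix M β T j k : ℝ) * θ₀ k := by
    rw [← hrel j, ← add_sum_erase _ _ (mem_univ j)]; ring
  have hdiag : ((r : ℝ) + d * (M * ℓ)) ≤ gridMatrix M β T j j := by
    have h1 := gridMatrix_diag M β T j
    have h2 : ((r + d * (M * ℓ) : ℕ) : ℤ) ≤ gridMatrix M β T j j :=
      le_trans (by exact_mod_cast h.le) h1
    exact_mod_cast h2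
  have hrow : ∑ k ∈ univ.erase j, |(gridMatrix M β T j k : ℝ)| ≤ d * (M * ℓ) := by
    exact_mod_cast sum_erase_abs_row_le M β T j
  have hlast : |(gridLast M β T j : ℝ)| ≤ M * ℓ := by
    rw [abs_of_nonneg (by exact_mod_cast gridLast_nonneg M β T j)]
    exact_mod_cast gridLast_le M β T j
  have h0 : (0 : ℝ) ≤ gridMatrix M β T j j := by exact_mod_cast gridMatrix_nonneg M β T j j
  have h1 : (gridMatrix M β T j j : ℝ) * |θ₀ j| ≤ M * ℓ + d * (M * ℓ) * |θ₀ j| := by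
    calc (gridMatrix M β T j j : ℝ) * |θ₀ j| = |(gridMatrix M β T j j : ℝ) * θ₀ j| := by
          rw [abs_mul, abs_of_nonneg h0]
      _ ≤ |(gridLast M β T j : ℝ)| + ∑ k ∈ univ.erase j, |(gridMatrix M β T j k : ℝ)| * |θ₀ j| := by
          rw [e]
          refine (abs_sub _ _).trans ?_
          rw [abs_neg]
          gcongr
          refine (abs_sum_le_sum_abs _ _).trans (sum_le_sum fun k _ => ?_)
          rw [abs_mul]
          exact mul_le_mul_of_nonneg_left (hj k (mem_univ k)) (abs_nonneg _)
      _ ≤ _ := by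
          rw [← sum_mul]
          gcongr
  have h2 : (r : ℝ) * |θ₀ j| ≤ M * ℓ := by
    have := mul_le_mul_of_nonneg_right hdiag (abs_nonneg (θ₀ j))
    linarith
  have h3 : (4 : ℝ) * (M * ℓ) ≤ r := by exact_mod_cast hMr
  have hrR : (0 : ℝ) < r := by exact_mod_cast hr
  have h4 : (r : ℝ) * |θ₀ j| ≤ r * (1 / 4) := by linarith
  exact le_of_mul_le_mul_left h4 hrR

/-- The points at which all rows of `(β I | 0) + M T` are relations up to an error `η`. -/
def gridCell {d ℓ : ℕ} (M β : ℕ) (T : Fin (d + 1) → Fin d → Fin ℓ) (η : ℝ) : Set (Fin d → ℝ) :=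
  {θ | ∀ i, |∑ j, (gridMatrix M β T i j : ℝ) * θ j + gridLast M β T i| ≤ η}

/-- Two rows of different matrices differ by a short vector, which cannot be an almost relation. -/
lemma eq_of_mem_gridCell {d ℓ M β r : ℕ} (hM : 0 < M) (hMr : M * ℓ < r) {c η : ℝ}
    (hη : 2 * η < c / (r : ℝ) ^ d) (hη1 : 2 * η < 1) {T T' : Fin (d + 1) → Fin d → Fin ℓ}
    {θ : Fin d → ℝ} (hθ : θ ∈ AvoidSet d r c) (h : θ ∈ gridCell M β T η)
    (h' : θ ∈ gridCell M β T' η) : T = T' := by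
  have hdiff : ∀ j i, gridCol M β j (T j) i - gridCol M β j (T' j) i =
      M * (((T j i : ℕ) : ℤ) - ((T' j i : ℕ) : ℤ)) := fun j i => by unfold gridCol; ring
  have hM' : (0 : ℤ) < M := by exact_mod_cast hM
  have hcomb : ∀ i, |∑ j, ((gridMatrix M β T i j - gridMatrix M β T' i j : ℤ) : ℝ) * θ j +
      ((gridLast M β T i - gridLast M β T' i : ℤ) : ℝ)| ≤ 2 * η := by
    intro i
    have e : ∑ j, ((gridMatrix M β T i j - gridMatrix M β T' i j : ℤ) : ℝ) * θ j +
        ((gridLast M β T i - gridLast M β T' i : ℤ) : ℝ) =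
        (∑ j, (gridMatrix M β T i j : ℝ) * θ j + gridLast M β T i) -
          (∑ j, (gridMatrix M β T' i j : ℝ) * θ j + gridLast M β T' i) := by
      push_cast
      simp only [sub_mul, sum_sub_distrib]
      ring
    rw [e]
    refine (abs_sub _ _).trans ?_
    have := h i
    have := h' i
    linarith
  have hrow : ∀ i j, gridMatrix M β T i j - gridMatrix M β T' i j = 0 := by
    intro i
    by_contra! hne
    have hne' : (fun j => gridMatrix M β T i j - gridMatrix M β T' i j) ≠ 0 := by
      obtain ⟨j, hj⟩ := hne
      exact fun e => hj (congrFun e j)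
    have h1 := hθ _ hne' (fun j => ?_) (gridLast M β T i - gridLast M β T' i)
    · exact absurd (h1.trans (hcomb i)) (not_le.2 hη)
    · simp only [gridMatrix, Matrix.of_apply]
      rw [hdiff, abs_mul, abs_of_pos hM']
      have h2 : |((T j.castSucc i : ℕ) : ℤ) - ((T' j.castSucc i : ℕ) : ℤ)| ≤ ℓ := by
        have := (T j.castSucc i).2
        have := (T' j.castSucc i).2
        rw [abs_le]; constructor <;> omega
      calc (M : ℤ) * _ ≤ M * ℓ := by gcongr
        _ < r := by exact_mod_cast hMr
  have hlast : ∀ i, gridLast M β T i - gridLast M β T' i = 0 := by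
    intro i
    have h1 := hcomb i
    simp only [hrow i, Int.cast_zero, zero_mul, sum_const_zero, zero_add] at h1
    exact Int.abs_lt_one_iff.1 (by exact_mod_cast h1.trans_lt hη1)
  have hall : ∀ j i, gridCol M β j (T j) i - gridCol M β j (T' j) i = 0 := by
    intro j i
    refine Fin.lastCases ?_ (fun j => ?_) j
    · exact hlast i
    · exact hrow i j
  funext j i
  have h1 := hall j i
  rw [hdiff] at h1
  have h2 := (mul_eq_zero.1 h1).resolve_left hM'.ne'
  apply Fin.ext
  omega

lemma ball_subset_gridCell {d ℓ M β r : ℕ} (hr : 0 < r) {ε : ℝ}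
    (hβ : β + d * (M * ℓ) ≤ 2 * r)
    (T : Fin (d + 1) → Fin d → Fin ℓ) {θ₀ : Fin d → ℝ}
    (hθ₀ : ∀ i, ∑ j, (gridMatrix M β T i j : ℝ) * θ₀ j + gridLast M β T i = 0) :
    Metric.ball θ₀ (ε / (2 * (r : ℝ) ^ (d + 1))) ⊆ gridCell M β T (ε / (r : ℝ) ^ d) := by
  intro θ hθ i
  have hrR : (0 : ℝ) < r := by exact_mod_cast hr
  rw [Metric.mem_ball] at hθ
  set δ := ε / (2 * (r : ℝ) ^ (d + 1)) with hδ
  have hδ0 : 0 ≤ δ := dist_nonneg.trans hθ.le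
  have h1 : ∀ j, |θ j - θ₀ j| ≤ δ := fun j => by
    rw [← Real.dist_eq]; exact (dist_le_pi_dist θ θ₀ j).trans hθ.le
  have e : ∑ j, (gridMatrix M β T i j : ℝ) * θ j + gridLast M β T i =
      ∑ j, (gridMatrix M β T i j : ℝ) * (θ j - θ₀ j) := by
    simp only [mul_sub, sum_sub_distrib]
    linarith [hθ₀ i]
  rw [e]
  have hsum : ∑ j, |(gridMatrix M β T i j : ℝ)| ≤ 2 * r := by
    have h2 := (sum_abs_gridMatrix_le M β T i).trans
      (show (β + d * (M * ℓ) : ℤ) ≤ 2 * r by exact_mod_cast hβ)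
    exact_mod_cast h2
  calc |∑ j, (gridMatrix M β T i j : ℝ) * (θ j - θ₀ j)|
      ≤ ∑ j, |(gridMatrix M β T i j : ℝ)| * δ := by
        refine (abs_sum_le_sum_abs _ _).trans (sum_le_sum fun j _ => ?_)
        rw [abs_mul]
        exact mul_le_mul_of_nonneg_left (h1 j) (abs_nonneg _)
    _ ≤ 2 * r * δ := by rw [← sum_mul]; gcongr
    _ = ε / (r : ℝ) ^ d := by rw [hδ]; field_simp; ring

lemma gridCell_subset_avoidSet {d ℓ M β r : ℕ} (hr : 0 < r) {c ε κ : ℝ}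
    (hcε : 0 ≤ c + d * ε)
    (h : r + d * (M * ℓ) < β) (hβ : (β + d * (M * ℓ) : ℝ) ≤ (1 + κ) * r)
    (hκc : (1 + κ) ^ d * (c + d * ε) < 1)
    {T : Fin (d + 1) → Fin d → Fin ℓ} (hT : Primitive M β T) :
    gridCell M β T (ε / (r : ℝ) ^ d) ⊆ AvoidSet d r c := by
  intro θ hθ
  have hrR : (0 : ℝ) < r := by exact_mod_cast hr
  refine mem_avoidSet_of_primitive hr (gridMatrix M β T) (gridLast M β T) ?_ ?_
    (det_gridMatrix_ne_zero (by omega) T) ?_ θ hθ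
  · intro p hp w h1 h2
    refine hT p hp w fun j => ?_
    refine Fin.lastCases ?_ (fun j => ?_) j
    · exact h2
    · exact h1 j
  · intro j
    have h1 := sum_erase_abs_col_le M β T j
    have h2 := gridMatrix_diag M β T j
    have h3 : (r + d * (M * ℓ) : ℤ) ≤ β := by exact_mod_cast h.le
    linarith
  · have h1 : |((gridMatrix M β T).det : ℝ)| ≤ ((1 + κ) * r) ^ d := by
      have h2 : |((gridMatrix M β T).det : ℝ)| ≤ (β + d * (M * ℓ) : ℝ) ^ d := by
        exact_mod_cast abs_det_gridMatrix_le M β T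
      exact h2.trans (pow_le_pow_left₀ (by positivity) hβ d)
    calc _ ≤ ((1 + κ) * r) ^ d * (c + d * ε) := mul_le_mul_of_nonneg_right h1 hcε
      _ = (r : ℝ) ^ d * ((1 + κ) ^ d * (c + d * ε)) := by rw [mul_pow]; ring
      _ < (r : ℝ) ^ d * 1 := by gcongr
      _ = _ := mul_one _

open Classical in
/-- The cells of distinct primitive matrices are disjoint parts of the set of points without short
almost relations, so that their number bounds its volume from below. -/
lemma volume_avoidSet_ge {d ℓ M β r : ℕ} (hd : 1 ≤ d) (hr : 0 < r) (hM : 0 < M) {c ε κ : ℝ}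
    (hε : 0 < ε) (hε1 : ε ≤ 1 / 4) (hεc : 2 * ε < c)
    (h : r + d * (M * ℓ) < β) (hβ : (β + d * (M * ℓ) : ℝ) ≤ (1 + κ) * r)
    (hβ2 : β + d * (M * ℓ) ≤ 2 * r)
    (hκc : (1 + κ) ^ d * (c + d * ε) < 1) (hMr : 4 * (M * ℓ) ≤ r) :
    ENNReal.ofReal (#{T : Fin (d + 1) → Fin d → Fin ℓ | Primitive M β T} *
        (ε / (r : ℝ) ^ (d + 1)) ^ d) ≤
      volume (AvoidSet d r c ∩ Metric.ball 0 (1 / 2)) := by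
  have hrR : (1 : ℝ) ≤ r := by exact_mod_cast hr
  have hr1 : (1 : ℝ) ≤ (r : ℝ) ^ (d + 1) := one_le_pow₀ hrR
  have hr2 : (1 : ℝ) ≤ (r : ℝ) ^ d := one_le_pow₀ hrR
  choose θ₀ hθ₀ hrel using fun T => exists_center (β := β) hr h hMr T
  set δ : ℝ := ε / (2 * (r : ℝ) ^ (d + 1)) with hδ
  have hδpos : 0 < δ := by positivity
  have hcε : 0 ≤ c + d * ε := by
    have : (0 : ℝ) < c := by linarith
    positivity
  have hδle : δ < 1 / 4 := by
    rw [hδ, div_lt_iff₀ (by positivity)]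
    nlinarith
  set S : Finset (Fin (d + 1) → Fin d → Fin ℓ) := {T | Primitive M β T} with hS
  have hcell : ∀ T, Metric.ball (θ₀ T) δ ⊆ gridCell M β T (ε / (r : ℝ) ^ d) := fun T =>
    ball_subset_gridCell hr hβ2 T (hrel T)
  have hsub : ∀ T ∈ S, Metric.ball (θ₀ T) δ ⊆ AvoidSet d r c := fun T hT =>
    (hcell T).trans (gridCell_subset_avoidSet hr hcε h hβ hκc
      (by simpa [hS] using hT))
  have hbox : ∀ T, Metric.ball (θ₀ T) δ ⊆ Metric.ball 0 (1 / 2) := by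
    intro T
    refine Metric.ball_subset_ball' ?_
    have : dist (θ₀ T) 0 ≤ 1 / 4 := by
      rw [dist_zero_right, pi_norm_le_iff_of_nonneg (by norm_num)]
      exact hθ₀ T
    linarith
  have hdisj : (S : Set (Fin (d + 1) → Fin d → Fin ℓ)).PairwiseDisjoint
      fun T => Metric.ball (θ₀ T) δ := by
    intro T hT T' hT' hne
    refine Set.disjoint_left.2 fun θ h1 h2 => hne ?_
    refine eq_of_mem_gridCell (c := c) (η := ε / (r : ℝ) ^ d) (r := r) hM (by omega) ?_ ?_
      (hsub T hT h1) (hcell T h1) (hcell T' h2)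
    · rw [← mul_div_assoc]; gcongr
    · rw [← mul_div_assoc, div_lt_one (by positivity)]; linarith
  calc _ = ∑ T ∈ S, volume (Metric.ball (θ₀ T) δ) := by
        have h1 : ∀ T ∈ S, volume (Metric.ball (θ₀ T) δ) =
            ENNReal.ofReal ((ε / (r : ℝ) ^ (d + 1)) ^ d) := by
          intro T _
          rw [Real.volume_pi_ball _ hδpos, Fintype.card_fin, hδ]
          congr 2
          field_simp
        rw [sum_congr rfl h1, sum_const, nsmul_eq_mul, ENNReal.ofReal_mul (by positivity),
          ENNReal.ofReal_natCast]
    _ = volume (⋃ T ∈ S, Metric.ball (θ₀ T) δ) :=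
        (measure_biUnion_finset hdisj fun _ _ => Metric.isOpen_ball.measurableSet).symm
    _ ≤ _ := measure_mono (Set.iUnion₂_subset fun T hT => Set.subset_inter (hsub T hT) (hbox T))

/-- The points without short almost relations fill a fixed proportion of the unit cube. -/
theorem exists_volume_avoidSet_ge {d : ℕ} (hd : 1 ≤ d) {c : ℝ} (hc0 : 0 < c) (hc1 : c < 1) :
    ∃ v : ℝ, 0 < v ∧ ∃ R : ℕ, ∀ r ≥ R,
      ENNReal.ofReal v ≤ volume (AvoidSet d r c ∩ Metric.ball 0 (1 / 2)) := by
  classical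
  obtain ⟨κ, hκ0, hκ1, hκ⟩ : ∃ κ : ℝ, 0 < κ ∧ κ ≤ 1 ∧ (1 + κ) ^ d * c < 1 := by
    have hcont : Tendsto (fun κ : ℝ => (1 + κ) ^ d * c) (𝓝[>] 0) (𝓝 ((1 + 0) ^ d * c)) :=
      (Continuous.tendsto (by fun_prop) 0).mono_left nhdsWithin_le_nhds
    have h1 := hcont.eventually_lt_const (show (1 + 0) ^ d * c < 1 by simpa using hc1)
    obtain ⟨κ, ⟨h2, h3⟩, h4⟩ := (h1.and self_mem_nhdsWithin |>.and
      (Ioc_mem_nhdsGT (show (0 : ℝ) < 1 by norm_num))).exists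
    exact ⟨κ, h3, h4.2, h2⟩
  obtain ⟨ε, hε0, hε1, hε2, hε⟩ : ∃ ε : ℝ, 0 < ε ∧ ε ≤ 1 / 4 ∧ 2 * ε < c ∧
      (1 + κ) ^ d * (c + d * ε) < 1 := by
    have hcont : Tendsto (fun ε : ℝ => (1 + κ) ^ d * (c + d * ε)) (𝓝[>] 0)
        (𝓝 ((1 + κ) ^ d * (c + d * 0))) :=
      (Continuous.tendsto (by fun_prop) 0).mono_left nhdsWithin_le_nhds
    have h1 := hcont.eventually_lt_const (show (1 + κ) ^ d * (c + d * 0) < 1 by simpa using hκ)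
    obtain ⟨ε, ⟨h2, h3⟩, h4⟩ := (h1.and self_mem_nhdsWithin |>.and
      (Ioo_mem_nhdsGT (show (0 : ℝ) < min (1 / 4) (c / 2) by positivity))).exists
    have h5 := h4.2.le.trans (min_le_left _ _)
    have h6 := h4.2.trans_le (min_le_right _ _)
    exact ⟨ε, h3, h5, by linarith, h2⟩
  obtain ⟨M, hM, ℓ₀, hcount⟩ := exists_primitive_card_ge d hd
  have hMR : (0 : ℝ) < M := by exact_mod_cast hM
  have hdR : (1 : ℝ) ≤ d := by exact_mod_cast hd
  -- the window `ℓ` has length between `η r` and `2 η r`, so that the entries of the matrices vary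
  -- over an interval of length at most `M ℓ ≤ κ r / (4 d)`
  set η : ℝ := κ / (8 * (d * M)) with hη
  have hη0 : 0 < η := by positivity
  refine ⟨η ^ (d * (d + 1)) * ε ^ d / 2, by positivity,
    ⌈max (1 / η) (max (2 * (M + 1) / κ) (max (2 / η ^ 2) (ℓ₀ / η)))⌉₊ + 1, fun r hr => ?_⟩
  have hr0 : 0 < r := by omega
  have hrR : (0 : ℝ) < r := by exact_mod_cast hr0
  have hrmax : max (1 / η) (max (2 * (M + 1) / κ) (max (2 / η ^ 2) (ℓ₀ / η))) ≤ r :=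
    (Nat.le_ceil _).trans (by exact_mod_cast (Nat.le_succ _).trans hr)
  simp only [max_le_iff] at hrmax
  obtain ⟨hr1, hr2, hr3, hr4⟩ := hrmax
  rw [div_le_iff₀ (by positivity)] at hr1 hr2 hr3 hr4
  set ℓ : ℕ := ⌊2 * (η * r)⌋₊ with hℓ
  have hℓle : (ℓ : ℝ) ≤ 2 * (η * r) := Nat.floor_le (by positivity)
  have hℓge : η * r ≤ ℓ := by
    have := Nat.lt_floor_add_one (2 * (η * r))
    rw [← hℓ] at this
    linarith
  have hdMℓ : (d * (M * ℓ) : ℝ) ≤ κ * r / 4 := by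
    calc (d * (M * ℓ) : ℝ) ≤ d * (M * (2 * (η * r))) := by gcongr
      _ = κ * r / 4 := by rw [hη]; field_simp; ring
  have hMℓ : (M * ℓ : ℝ) ≤ d * (M * ℓ) := le_mul_of_one_le_left (by positivity) hdR
  have hκr : κ * r ≤ r := by nlinarith
  -- `β ≡ 1` modulo `M`, and `β` exceeds the off-diagonal sums by at least `r` and not much more
  set β : ℕ := 1 + M * ((r + d * (M * ℓ)) / M + 1) with hβdef
  have hβ1 : β ≡ 1 [MOD M] := by
    rw [hβdef]
    exact (Nat.modEq_iff_dvd' (by omega)).2 (by simp) |>.symm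
  have hβgt : r + d * (M * ℓ) < β := by
    have := Nat.lt_mul_div_succ (r + d * (M * ℓ)) hM
    omega
  have hβle : β ≤ r + d * (M * ℓ) + M + 1 := by
    have := Nat.mul_div_le (r + d * (M * ℓ)) M
    rw [hβdef, mul_add]
    omega
  have hβleR : (β : ℝ) ≤ r + d * (M * ℓ) + M + 1 := by exact_mod_cast hβle
  have hβκ : (β + d * (M * ℓ) : ℝ) ≤ (1 + κ) * r := by nlinarith
  have hβ2 : β + d * (M * ℓ) ≤ 2 * r := by
    have : (β + d * (M * ℓ) : ℝ) ≤ 2 * r := by nlinarith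
    exact_mod_cast this
  have hℓsq : 2 * r ≤ ℓ ^ 2 := by
    have : (2 * r : ℝ) ≤ (ℓ : ℝ) ^ 2 := by
      calc (2 * r : ℝ) ≤ (r * η ^ 2) * r := by gcongr
        _ = (η * r) ^ 2 := by ring
        _ ≤ _ := by gcongr
    exact_mod_cast this
  have hℓ₀ : ℓ₀ ≤ ℓ := by
    have : (ℓ₀ : ℝ) ≤ ℓ := by linarith
    exact_mod_cast this
  have h4 : 4 * (M * ℓ) ≤ r := by
    have : (4 * (M * ℓ) : ℝ) ≤ r := by linarith
    exact_mod_cast this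
  refine le_trans (ENNReal.ofReal_le_ofReal ?_)
    (volume_avoidSet_ge hd hr0 hM hε0 hε1 hε2 hβgt hβκ hβ2 hε h4)
  clear_value η
  have hN := hcount ℓ hℓ₀ β hβ1 (by omega) (hβ2.trans hℓsq)
  calc η ^ (d * (d + 1)) * ε ^ d / 2
      = (η * r) ^ (d * (d + 1)) / 2 * (ε / (r : ℝ) ^ (d + 1)) ^ d := by
        rw [div_pow ε, ← pow_mul, mul_pow, mul_comm (d + 1) d]
        field_simp
    _ ≤ (ℓ : ℝ) ^ (d * (d + 1)) / 2 * (ε / (r : ℝ) ^ (d + 1)) ^ d := by gcongr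
    _ ≤ _ := by
        gcongr
        linarith

/-! ### Integer multiples and limit superior sets -/

lemma isClosed_avoidSet (d r : ℕ) (c : ℝ) : IsClosed (AvoidSet d r c) := by
  simp only [AvoidSet, Set.ofPred_forall]
  refine isClosed_iInter fun b => isClosed_iInter fun _ => isClosed_iInter fun _ =>
    isClosed_iInter fun m => isClosed_le (by fun_prop) (by fun_prop)

lemma add_int_mem_avoidSet {d r : ℕ} {c : ℝ} {θ : Fin d → ℝ} (h : θ ∈ AvoidSet d r c)
    (j : Fin d → ℤ) : (fun i => θ i + j i) ∈ AvoidSet d r c := by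
  intro b hb hbr m
  have := h b hb hbr (m + ∑ i, b i * j i)
  convert this using 2
  push_cast
  simp only [mul_add, sum_add_distrib]
  ring

/-- The part of the unit cube which multiplication by `N` takes into the periodic set `AvoidSet`. -/
def ScaledAvoidSet (d r N : ℕ) (c : ℝ) : Set (Fin d → ℝ) :=
  {ξ | ξ ∈ Metric.ball 0 (1 / 2) ∧ (N : ℝ) • ξ ∈ AvoidSet d r c}

lemma measurableSet_scaledAvoidSet (d r N : ℕ) (c : ℝ) :
    MeasurableSet (ScaledAvoidSet d r N c) :=
  Metric.isOpen_ball.measurableSet.inter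
    ((isClosed_avoidSet d r c).preimage (continuous_const_smul (N : ℝ))).measurableSet

/-- Multiplication by an odd `N` preserves the volume of periodic sets; oddness makes the unit cube
centred at the origin a union of `N ^ d` cubes of side `1 / N` centred at the points of
`N⁻¹ ℤ ^ d`. -/
lemma volume_scaledAvoidSet_ge (d r h : ℕ) (c : ℝ) :
    volume (AvoidSet d r c ∩ Metric.ball 0 (1 / 2)) ≤
      volume (ScaledAvoidSet d r (2 * h + 1) c) := by
  set A : Set (Fin d → ℝ) := AvoidSet d r c ∩ Metric.ball 0 (1 / 2) with hA
  have hAm : MeasurableSet A :=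
    (isClosed_avoidSet d r c).measurableSet.inter Metric.isOpen_ball.measurableSet
  set N : ℝ := ((2 * h + 1 : ℕ) : ℝ) with hN
  have hNpos : 0 < N := by rw [hN]; positivity
  let J : Finset (Fin d → ℤ) := Fintype.piFinset fun _ => Icc (-(h : ℤ)) h
  let F : (Fin d → ℤ) → Set (Fin d → ℝ) := fun j =>
    (fun ξ => N • ξ) ⁻¹' ((fun ξ => ξ + fun i => -(j i : ℝ)) ⁻¹' A)
  have hFm : ∀ j, MeasurableSet (F j) := fun j =>
    (hAm.preimage (measurable_add_const _)).preimage (measurable_const_smul N)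
  have hFv : ∀ j, volume (F j) = ENNReal.ofReal ((N ^ d)⁻¹) * volume A := by
    intro j
    simp only [F]
    rw [Measure.addHaar_preimage_smul _ hNpos.ne', measure_preimage_add_right,
      Module.finrank_fintype_fun_eq_card, Fintype.card_fin, abs_of_pos (by positivity)]
  have hmem : ∀ j ξ, ξ ∈ F j → (∀ i, |N * ξ i - j i| < 1 / 2) ∧ N • ξ ∈ AvoidSet d r c := by
    intro j ξ hξ
    have h1 : ((fun i => N * ξ i + -(j i : ℝ)) : Fin d → ℝ) ∈ A := hξ
    refine ⟨fun i => ?_, ?_⟩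
    · have h2 := h1.2
      rw [Metric.mem_ball, dist_zero_right, pi_norm_lt_iff (by norm_num)] at h2
      simpa [sub_eq_add_neg] using h2 i
    · have := add_int_mem_avoidSet h1.1 j
      convert this using 1
      funext i
      simp
  have hdisj : (J : Set (Fin d → ℤ)).PairwiseDisjoint F := by
    intro j _ j' _ hne
    refine Set.disjoint_left.2 fun ξ h1 h2 => hne ?_
    funext i
    have h3 := abs_lt.1 ((hmem j ξ h1).1 i)
    have h4 := abs_lt.1 ((hmem j' ξ h2).1 i)
    have h5 : |((j i - j' i : ℤ) : ℝ)| < 1 := by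
      push_cast; rw [abs_lt]; constructor <;> linarith [h3.1, h3.2, h4.1, h4.2]
    have : j i - j' i = 0 := Int.abs_lt_one_iff.1 (by exact_mod_cast h5)
    linarith
  have hsub : ∀ j ∈ J, F j ⊆ ScaledAvoidSet d r (2 * h + 1) c := by
    intro j hj ξ hξ
    obtain ⟨h1, h2⟩ := hmem j ξ hξ
    refine ⟨?_, h2⟩
    rw [Metric.mem_ball, dist_zero_right, pi_norm_lt_iff (by norm_num)]
    intro i
    have h3 := Fintype.mem_piFinset.1 hj i
    rw [mem_Icc] at h3
    have h4 : (-(h : ℝ)) ≤ j i := by exact_mod_cast h3.1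
    have h5 : (j i : ℝ) ≤ h := by exact_mod_cast h3.2
    have h6 := abs_lt.1 (h1 i)
    have h7 : |N * ξ i| < N * (1 / 2) := by
      have : N = 2 * h + 1 := by rw [hN]; push_cast; ring
      rw [abs_lt]; constructor <;> linarith [h6.1, h6.2]
    rw [abs_mul, abs_of_pos hNpos] at h7
    exact lt_of_mul_lt_mul_left h7 hNpos.le
  have hJ : #J = (2 * h + 1) ^ d := by
    simp only [J, Fintype.card_piFinset, Int.card_Icc, prod_const, card_univ, Fintype.card_fin]
    congr 1
    omega
  calc volume A = ∑ j ∈ J, volume (F j) := by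
        rw [sum_congr rfl fun j _ => hFv j, sum_const, nsmul_eq_mul, hJ, ← mul_assoc,
          ← ENNReal.ofReal_natCast, ← ENNReal.ofReal_mul (by positivity)]
        rw [show (((2 * h + 1) ^ d : ℕ) : ℝ) * (N ^ d)⁻¹ = 1 by
          rw [hN]; push_cast; exact mul_inv_cancel₀ (by positivity)]
        simp
    _ = volume (⋃ j ∈ J, F j) := (measure_biUnion_finset hdisj fun j _ => hFm j).symm
    _ ≤ _ := measure_mono (Set.iUnion₂_subset hsub)

/-- The reverse Fatou inequality for sets. -/
lemma le_measure_setOf_frequently {α : Type*} [MeasurableSpace α] {μ : Measure α} {s : ℕ → Set α}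
    (hs : ∀ k, MeasurableSet (s k)) {U : Set α} (hU : μ U ≠ ⊤) (hsU : ∀ k, s k ⊆ U) {v : ℝ≥0∞}
    (hv : ∀ᶠ k in atTop, v ≤ μ (s k)) : v ≤ μ {x | ∃ᶠ k in atTop, x ∈ s k} := by
  set t : ℕ → Set α := fun m => ⋃ k ≥ m, s k with ht
  have e : {x | ∃ᶠ k in atTop, x ∈ s k} = ⋂ m, t m := by
    ext x
    simp [ht, frequently_atTop]
  have hanti : Antitone t := fun m m' hm =>
    Set.iUnion₂_subset fun k hk => Set.subset_biUnion_of_mem (u := s) (le_trans hm hk)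
  have hfin : μ (t 0) ≠ ⊤ :=
    ne_top_of_le_ne_top hU (measure_mono (Set.iUnion₂_subset fun k _ => hsU k))
  have hlim := tendsto_measure_iInter_atTop (μ := μ)
    (fun m => (MeasurableSet.iUnion fun k => MeasurableSet.iUnion fun _ => hs k).nullMeasurableSet)
    hanti ⟨0, hfin⟩
  rw [e]
  refine ge_of_tendsto hlim ?_
  filter_upwards [hv] with m hm
  exact hm.trans (measure_mono (Set.subset_biUnion_of_mem (u := s) (le_refl m)))

end Folklore

namespace Folklore

/-! ### Two interlaced sequences of rational approximations -/

/-- A short interval contains a fraction of any sufficiently large prime denominator, with room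
to the right of it. -/
lemma exists_prime_fraction {lo hi : ℝ} (hlo : 0 < lo) (hlt : lo < hi) (hhi : hi ≤ 1) (K : ℕ) :
    ∃ p q : ℕ, q.Prime ∧ K ≤ q ∧ 0 < p ∧ p + 2 ≤ q ∧ lo ≤ (p : ℝ) / q ∧ ((p : ℝ) + 2) / q ≤ hi := by
  obtain ⟨q, hq, hqp⟩ := Nat.exists_infinite_primes (max K ⌈3 / (hi - lo)⌉₊)
  have hq0 : (0 : ℝ) < q := by exact_mod_cast hqp.pos
  have h3 : 3 ≤ (hi - lo) * q := by
    have h1 : 3 / (hi - lo) ≤ q :=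
      (Nat.le_ceil _).trans (by exact_mod_cast (le_max_right _ _).trans hq)
    rw [div_le_iff₀ (by linarith)] at h1
    linarith
  have h4 : ((⌈lo * q⌉₊ : ℕ) : ℝ) + 2 ≤ hi * q := by
    have := Nat.ceil_lt_add_one (show 0 ≤ lo * q by positivity)
    linarith
  refine ⟨⌈lo * q⌉₊, q, hqp, (le_max_left _ _).trans hq, Nat.ceil_pos.2 (by positivity), ?_, ?_, ?_⟩
  · have : ((⌈lo * q⌉₊ : ℕ) : ℝ) + 2 ≤ q := by nlinarith
    exact_mod_cast this
  · rw [le_div_iff₀ hq0]; exact Nat.le_ceil _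
  · rwa [div_le_iff₀ hq0]

/-- The data of two interlaced sequences of rational approximations `p k / q k` with rapidly growing
prime denominators: those of even index converge to `z 0`, those of odd index to `z 1`, and the
error at index `k` is asymptotically `c / q (k + 1) ^ n`. -/
structure Interlaced (n : ℕ) (c : ℝ) (p q : ℕ → ℕ) (z : ℕ → ℝ) : Prop where
  prime : ∀ k, (q k).Prime
  two_lt : ∀ k, 2 < q k
  pos : ∀ k, 0 < p k
  lt : ∀ k, p k < q k
  growth : ∀ k, (k + 1) * q k + 1 ≤ q (k + 1)
  period : ∀ k, z (k + 2) = z k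
  le_err : ∀ k, c / (q (k + 1) : ℝ) ^ n ≤ q k * z k - p k
  err_le : ∀ k, q k * z k - p k ≤ (c + 1 / ((k : ℝ) + 1)) / (q (k + 1) : ℝ) ^ n

lemma exists_interlaced (n : ℕ) {c : ℝ} (hc0 : 0 ≤ c) (hc1 : c ≤ 1) :
    ∃ p q z, Interlaced n c p q z := by
  let S := {s : ℕ × ℕ // s.2.Prime ∧ 2 < s.2 ∧ 0 < s.1 ∧ s.1 + 2 ≤ s.2}
  -- given the fractions of index `k` and `k + 1`, the limit of the parity of `k` has to lie between
  -- `lo` and `hi k`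
  let lo : S → S → ℝ := fun s s' => s.1.1 / s.1.2 + c / (s'.1.2 : ℝ) ^ n / s.1.2
  let hi : ℕ → S → S → ℝ := fun k s s' =>
    s.1.1 / s.1.2 + (c + 1 / ((k : ℝ) + 1)) / (s'.1.2 : ℝ) ^ n / s.1.2
  have hq0 : ∀ s : S, (0 : ℝ) < s.1.2 := fun s => by exact_mod_cast s.2.1.pos
  have hk0 : ∀ k : ℕ, (0 : ℝ) < 1 / ((k : ℝ) + 1) := fun k => by positivity
  have hk1 : ∀ k : ℕ, 1 / ((k : ℝ) + 1) ≤ 1 := fun k => by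
    rw [div_le_one (by positivity)]; linarith [(Nat.cast_nonneg k : (0 : ℝ) ≤ k)]
  have hlolt : ∀ k s s', lo s s' < hi k s s' := by
    intro k s s'
    have := hq0 s
    have := hq0 s'
    simp only [lo, hi]
    gcongr
    linarith [hk0 k]
  have hhi : ∀ k s s', hi k s s' ≤ ((s.1.1 : ℝ) + 2) / s.1.2 := by
    intro k s s'
    have h1 := hq0 s
    have h2 : (1 : ℝ) ≤ (s'.1.2 : ℝ) ^ n := one_le_pow₀ (by exact_mod_cast s'.2.1.one_le)
    simp only [hi]
    rw [add_div (s.1.1 : ℝ) 2]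
    gcongr
    rw [div_le_iff₀ (by positivity)]
    linarith [hk1 k]
  have hlo : ∀ s s', (s.1.1 : ℝ) / s.1.2 ≤ lo s s' := by
    intro s s'
    have := hq0 s
    have := hq0 s'
    simp only [lo]
    have : 0 ≤ c / (s'.1.2 : ℝ) ^ n / s.1.2 := by positivity
    linarith
  have step : ∀ k s s', ∃ s'' : S, (k + 2) * s'.1.2 + 1 ≤ s''.1.2 ∧
      lo s s' ≤ (s''.1.1 : ℝ) / s''.1.2 ∧ ((s''.1.1 : ℝ) + 2) / s''.1.2 ≤ hi k s s' := by
    intro k s s'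
    have h1 : 0 < lo s s' := by
      refine lt_of_lt_of_le ?_ (hlo s s')
      have : (0 : ℝ) < s.1.1 := by exact_mod_cast s.2.2.2.1
      exact div_pos this (hq0 s)
    have h2 : hi k s s' ≤ 1 := by
      refine (hhi k s s').trans ?_
      rw [div_le_one (hq0 s)]
      exact_mod_cast s.2.2.2.2
    obtain ⟨p, q, hq, hK, hp, hpq, h3, h4⟩ :=
      exists_prime_fraction h1 (hlolt k s s') h2 (max 3 ((k + 2) * s'.1.2 + 1))
    exact ⟨⟨(p, q), hq, (le_max_left _ _).trans hK, hp, hpq⟩, (le_max_right _ _).trans hK, h3, h4⟩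
  choose next hnext using step
  -- the state consists of two consecutive fractions
  let W : ℕ → S × S := fun k => Nat.rec
    (⟨(1, 5), by norm_num⟩, ⟨(1, 7), by norm_num⟩) (fun k w => (w.2, next k w.1 w.2)) k
  let s : ℕ → S := fun k => (W k).1
  have hW : ∀ k, s (k + 2) = next k (s k) (s (k + 1)) := fun k => rfl
  have hW1 : ∀ k, (W k).2 = s (k + 1) := fun k => rfl
  have hgrow : ∀ k, (k + 1) * (s k).1.2 + 1 ≤ (s (k + 1)).1.2 := by
    intro k
    cases k with
    | zero =>
      change (0 + 1) * 5 + 1 ≤ 7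
      norm_num
    | succ k =>
      rw [show k + 1 + 1 = k + 2 from rfl, hW k]
      exact (hnext k (s k) (s (k + 1))).1
  let a : ℕ → ℝ := fun k => lo (s k) (s (k + 1))
  let b : ℕ → ℝ := fun k => hi k (s k) (s (k + 1))
  have ha : ∀ k, a k ≤ a (k + 2) := by
    intro k
    have h1 := (hnext k (s k) (s (k + 1))).2.1
    rw [← hW] at h1
    exact h1.trans (hlo _ _)
  have hb : ∀ k, b (k + 2) ≤ b k := by
    intro k
    have h1 := (hnext k (s k) (s (k + 1))).2.2
    rw [← hW] at h1
    exact (hhi _ _ _).trans h1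
  -- the common point of the nested intervals of the parity of `k`
  let z : ℕ → ℝ := fun k => ⨆ j, a (k % 2 + 2 * j)
  have hz : ∀ k, a k ≤ z k ∧ z k ≤ b k := by
    intro k
    have hmono : Monotone fun j => a (k % 2 + 2 * j) :=
      monotone_nat_of_le_succ fun j => ha (k % 2 + 2 * j)
    have hanti : Antitone fun j => b (k % 2 + 2 * j) :=
      antitone_nat_of_succ_le fun j => hb (k % 2 + 2 * j)
    have h1 := hmono.ciSup_mem_iInter_Icc_of_antitone hanti fun j => (hlolt _ _ _).le
    have h2 := Set.mem_iInter.1 h1 (k / 2)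
    rw [Set.mem_Icc, Nat.mod_add_div] at h2
    exact h2
  refine ⟨fun k => (s k).1.1, fun k => (s k).1.2, z, ⟨fun k => (s k).2.1, fun k => (s k).2.2.1,
    fun k => (s k).2.2.2.1, fun k => ?_, hgrow, fun k => ?_, fun k => ?_, fun k => ?_⟩⟩
  · have := (s k).2.2.2.2
    omega
  · simp [z]
  · have h1 := (hz k).1
    have h2 := hq0 (s k)
    simp only [a, lo] at h1
    rw [← add_div, div_le_iff₀ h2] at h1
    linarith
  · have h1 := (hz k).2
    have h2 := hq0 (s k)
    simp only [b, hi] at h1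
    rw [← add_div, le_div_iff₀ h2] at h1
    linarith

end Folklore

namespace Folklore

open Finset

/-! ### Lower bounds for linear forms -/

/-- Let `y` be close to `p / q` and let `x` be extremely close to `s / r`, with prime denominators
`q < r`. If `q r θ` has no short almost relation, then up to height `r` no linear form in `(θ, x, y)`
takes a value smaller than the form `q y - p`. -/
lemma le_abs_linear_form {d p q s r : ℕ} (hq : q.Prime) (hr : r.Prime) (hp0 : 0 < p) (hpq : p < q)
    (hs0 : 0 < s) (hsr : s < r) (hqr : q < r) {c c' δ x y : ℝ} (hc' : c' ≤ 1) (hc0 : 0 ≤ c)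
    (hy1 : c / (r : ℝ) ^ (d + 2) ≤ q * y - p) (hy2 : q * y - p ≤ (c + δ) / (r : ℝ) ^ (d + 2))
    (hx0 : 0 ≤ r * x - s) (hx : r * x - s ≤ 1 / (r : ℝ) ^ (d + 2))
    (hgap : (c + 1) * q ≤ (c' - c - δ) * r) {θ : Fin d → ℝ}
    (hθ : ((q * r : ℕ) : ℝ) • θ ∈ AvoidSet d r c') (b : Fin d → ℤ) (u v a : ℤ)
    (hb : ∀ i, |b i| < (r : ℤ)) (hu : |u| < (r : ℤ)) (hv : |v| < (r : ℤ))
    (hne : b ≠ 0 ∨ u ≠ 0 ∨ v ≠ 0) :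
    c / (r : ℝ) ^ (d + 2) ≤ |∑ i, (b i : ℝ) * θ i + u * x + v * y + a| := by
  have hqR : (0 : ℝ) < q := by exact_mod_cast hq.pos
  have hrR : (0 : ℝ) < r := by exact_mod_cast hr.pos
  have hr1 : (1 : ℝ) ≤ r := by exact_mod_cast hr.one_le
  -- the form multiplied by `q r` is the main term `W` plus two errors
  set w : ℤ := u * s * q + v * p * r + a * q * r with hw
  set L : ℝ := ∑ i, (b i : ℝ) * θ i + u * x + v * y + a with hL
  set W : ℝ := ∑ i, (b i : ℝ) * (((q * r : ℕ) : ℝ) • θ) i + w with hWdef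
  have hLW : (q * r : ℝ) * L = W + u * q * (r * x - s) + v * r * (q * y - p) := by
    have e : ∑ i, (b i : ℝ) * (((q * r : ℕ) : ℝ) • θ) i = (q * r : ℝ) * ∑ i, (b i : ℝ) * θ i := by
      rw [mul_sum]
      refine sum_congr rfl fun i _ => ?_
      simp only [Pi.smul_apply, smul_eq_mul]
      push_cast
      ring
    rw [hWdef, hL, e, hw]
    push_cast
    ring
  have huR : |(u : ℝ)| ≤ r := by exact_mod_cast hu.le
  have hvR : |(v : ℝ)| ≤ r := by exact_mod_cast hv.le
  -- the main term is bounded away from `0` unless it vanishes for trivial reasons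
  have hmain : c' / (r : ℝ) ^ d ≤ |W| → c / (r : ℝ) ^ (d + 2) ≤ |L| := by
    intro hW
    have h1 : |u * q * (r * x - s)| ≤ r * q * (1 / (r : ℝ) ^ (d + 2)) := by
      rw [abs_mul, abs_mul, abs_of_pos hqR, abs_of_nonneg hx0]
      gcongr
    have hyn : 0 ≤ q * y - p := le_trans (by positivity) hy1
    have h2 : |v * r * (q * y - p)| ≤ r * r * ((c + δ) / (r : ℝ) ^ (d + 2)) := by
      rw [abs_mul, abs_mul, abs_of_pos hrR, abs_of_nonneg hyn]
      gcongr
    have h3 : |W| ≤ (q * r : ℝ) * |L| + |u * q * (r * x - s)| + |v * r * (q * y - p)| := by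
      have e : W = (q * r : ℝ) * L - u * q * (r * x - s) - v * r * (q * y - p) := by
        rw [hLW]; ring
      have h4 := abs_sub ((q * r : ℝ) * L - u * q * (r * x - s)) (v * r * (q * y - p))
      have h5 := abs_sub ((q * r : ℝ) * L) (u * q * (r * x - s))
      rw [← e] at h4
      rw [abs_mul (q * r : ℝ), abs_of_pos (mul_pos hqR hrR)] at h5
      linarith
    have h6 : c' / (r : ℝ) ^ d = c' * r ^ 2 * (1 / (r : ℝ) ^ (d + 2)) := by
      field_simp; ring
    have h7 : (q * r : ℝ) * (c / (r : ℝ) ^ (d + 2)) ≤ (q * r : ℝ) * |L| := by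
      have h8 : (c + 1) * q * r ≤ (c' - c - δ) * r * r := by gcongr
      have h9 : (0 : ℝ) ≤ 1 / (r : ℝ) ^ (d + 2) := by positivity
      have h10 := mul_le_mul_of_nonneg_right h8 h9
      have e1 : (q * r : ℝ) * (c / (r : ℝ) ^ (d + 2)) = q * r * c * (1 / (r : ℝ) ^ (d + 2)) := by ring
      have e2 : r * r * ((c + δ) / (r : ℝ) ^ (d + 2)) =
          r * r * (c + δ) * (1 / (r : ℝ) ^ (d + 2)) := by ring
      rw [e1]
      rw [e2] at h2
      rw [h6] at hW
      nlinarith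
    exact le_of_mul_le_mul_left h7 (mul_pos hqR hrR)
  by_cases hb0 : b = 0
  · have hW : W = w := by simp [hWdef, hb0]
    by_cases hw0 : w = 0
    · -- divisibility forces the form to be a multiple of `q y - p`
      have hrs : ¬ (r : ℤ) ∣ s := fun h => by
        have := Nat.le_of_dvd hs0 (Int.natCast_dvd_natCast.1 h)
        omega
      have hrq : ¬ (r : ℤ) ∣ q := fun h => by
        have := Nat.le_of_dvd hq.pos (Int.natCast_dvd_natCast.1 h)
        omega
      have hqp : ¬ (q : ℤ) ∣ p := fun h => by
        have := Nat.le_of_dvd hp0 (Int.natCast_dvd_natCast.1 h)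
        omega
      have hrZ : Prime (r : ℤ) := Nat.prime_iff_prime_int.1 hr
      have hqZ : Prime (q : ℤ) := Nat.prime_iff_prime_int.1 hq
      have hu0 : u = 0 := by
        have h1 : (r : ℤ) ∣ u * s * q :=
          ⟨-(v * p + a * q), by rw [hw] at hw0; linear_combination hw0⟩
        rcases hrZ.dvd_or_dvd h1 with h1 | h1
        · rcases hrZ.dvd_or_dvd h1 with h1 | h1
          · exact Int.eq_zero_of_abs_lt_dvd h1 hu
          · exact absurd h1 hrs
        · exact absurd h1 hrq
      have h2 : v * p + a * q = 0 := by
        have h3 : (r : ℤ) * (v * p + a * q) = 0 := by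
          rw [hw, hu0] at hw0; linear_combination hw0
        exact (mul_eq_zero.1 h3).resolve_left (by exact_mod_cast hr.pos.ne')
      have h4 : (q : ℤ) ∣ v :=
        (hqZ.dvd_or_dvd
          (show (q : ℤ) ∣ v * p from ⟨-a, by linear_combination h2⟩)).resolve_right hqp
      have hv0 : v ≠ 0 := by
        rcases hne with h | h | h
        · exact absurd hb0 h
        · exact absurd hu0 h
        · exact h
      have h5 : (q : ℝ) ≤ |(v : ℝ)| := by
        have : (q : ℤ) ≤ |v| := Int.le_of_dvd (abs_pos.2 hv0) ((dvd_abs _ _).2 h4)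
        exact_mod_cast this
      have h6 : (q : ℝ) * L = v * (q * y - p) := by
        have h7 : (v * p + a * q : ℝ) = 0 := by exact_mod_cast h2
        have h8 : L = v * y + a := by simp [hL, hb0, hu0]
        rw [h8]; linear_combination h7
      have hyn : 0 ≤ q * y - p := le_trans (by positivity) hy1
      have h9 : (q : ℝ) * (q * y - p) ≤ q * |L| := by
        calc (q : ℝ) * (q * y - p) ≤ |(v : ℝ)| * (q * y - p) := by gcongr
          _ = |(q : ℝ) * L| := by rw [h6, abs_mul, abs_of_nonneg hyn]
          _ = q * |L| := by rw [abs_mul, abs_of_pos hqR]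
      exact hy1.trans (le_of_mul_le_mul_left h9 hqR)
    · refine hmain ?_
      have h1 : (1 : ℝ) ≤ |W| := by
        rw [hW]
        exact_mod_cast Int.one_le_abs hw0
      refine le_trans ?_ h1
      rw [div_le_one (by positivity)]
      exact hc'.trans (one_le_pow₀ hr1)
  · exact hmain (hθ b hb0 hb w)

/-- The point with coordinates `θ`, followed by `x` and `y`. -/
def extend {d : ℕ} (θ : Fin d → ℝ) (x y : ℝ) : Fin (d + 2) → ℝ :=
  Fin.snoc (α := fun _ => ℝ) (Fin.snoc (α := fun _ => ℝ) θ x) y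

lemma sum_mul_extend {d : ℕ} (θ : Fin d → ℝ) (x y : ℝ) (b : Fin (d + 2) → ℝ) :
    ∑ i, b i * extend θ x y i = ∑ i : Fin d, b i.castSucc.castSucc * θ i +
      b (Fin.last d).castSucc * x + b (Fin.last (d + 1)) * y := by
  rw [Fin.sum_univ_castSucc, Fin.sum_univ_castSucc]
  simp [extend]

lemma psi_le {n : ℕ} {ξ : Fin n → ℝ} {t : ℝ} (b : Fin n → ℤ) (a : ℤ) (h1 : 1 ≤ ‖b‖)
    (h2 : ‖b‖ ≤ t) : psi ξ t ≤ |∑ i, (b i : ℝ) * ξ i + a| :=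
  csInf_le ⟨0, by rintro _ ⟨b, a, _, _, rfl⟩; exact abs_nonneg _⟩ ⟨b, a, h1, h2, rfl⟩

lemma le_psi {n : ℕ} [NeZero n] {ξ : Fin n → ℝ} {t K : ℝ} (ht : 1 ≤ t)
    (h : ∀ (b : Fin n → ℤ) (a : ℤ), b ≠ 0 → (∀ i, (|b i| : ℝ) ≤ t) →
      K ≤ |∑ i, (b i : ℝ) * ξ i + a|) : K ≤ psi ξ t := by
  refine le_csInf ?_ ?_
  · have h1 : ‖(Pi.single 0 1 : Fin n → ℤ)‖ = 1 := by simp [Pi.norm_single]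
    exact ⟨_, Pi.single 0 1, 0, h1.ge, h1.trans_le ht, rfl⟩
  · rintro _ ⟨b, a, h1, h2, rfl⟩
    refine h b a (fun h0 => ?_) fun i => ?_
    · rw [h0, norm_zero] at h1; linarith
    · rw [← Int.norm_eq_abs]
      exact (norm_le_pi_norm b i).trans h2

lemma psi_nonneg {n : ℕ} (ξ : Fin n → ℝ) (t : ℝ) : 0 ≤ psi ξ t :=
  Real.sInf_nonneg (by rintro _ ⟨b, a, _, _, rfl⟩; exact abs_nonneg _)

/-! ### The Dirichlet constant of the extended points -/

variable {n d : ℕ} {c : ℝ} {p q : ℕ → ℕ} {z : ℕ → ℝ}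

namespace Interlaced

lemma q_pos (h : Interlaced n c p q z) (k : ℕ) : (0 : ℝ) < q k := by
  exact_mod_cast (h.prime k).pos

lemma lt_succ (h : Interlaced n c p q z) (k : ℕ) : q k < q (k + 1) := by
  have := h.growth k
  nlinarith

lemma strictMono (h : Interlaced n c p q z) : StrictMono q := strictMono_nat_of_lt_succ h.lt_succ

lemma growth_real (h : Interlaced n c p q z) (k : ℕ) : ((k : ℝ) + 1) * q k ≤ q (k + 1) := by
  have h1 : (k + 1) * q k ≤ q (k + 1) := (Nat.le_succ _).trans (h.growth k)
  exact_mod_cast h1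

lemma tendsto_real (h : Interlaced n c p q z) : Tendsto (fun k => (q k : ℝ)) atTop atTop :=
  tendsto_natCast_atTop_atTop.comp h.strictMono.tendsto_atTop

lemma err_nonneg (h : Interlaced n c p q z) (hc : 0 ≤ c) (k : ℕ) : 0 ≤ q k * z k - p k :=
  le_trans (by have := h.q_pos (k + 1); positivity) (h.le_err k)

/-- The form `q k * z k - p k` in the last two coordinates bounds the best approximations. -/
lemma psi_extend_le (h : Interlaced n c p q z) (hc : 0 ≤ c) (θ : Fin d → ℝ) (k : ℕ) {t : ℝ}
    (ht : q k ≤ t) :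
    psi (extend θ (z 0) (z 1)) t ≤ (c + 1 / ((k : ℝ) + 1)) / (q (k + 1) : ℝ) ^ n := by
  refine le_trans ?_ (h.err_le k)
  have hq1 : (1 : ℝ) ≤ q k := by exact_mod_cast (h.prime k).one_le
  have hz : z k = z (k % 2) := by
    conv_lhs => rw [← Nat.mod_add_div k 2]
    generalize k / 2 = j
    induction j with
    | zero => rfl
    | succ j ih => rw [← ih, mul_add, mul_one, ← add_assoc, h.period]
  obtain ⟨i, hi⟩ : ∃ i : Fin (d + 2), extend θ (z 0) (z 1) i = z k := by
    rcases Nat.mod_two_eq_zero_or_one k with h0 | h0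
    · exact ⟨(Fin.last d).castSucc, by rw [hz, h0]; simp [extend]⟩
    · exact ⟨Fin.last (d + 1), by rw [hz, h0]; simp [extend]⟩
  have hnorm : ‖(Pi.single i (q k : ℤ) : Fin (d + 2) → ℤ)‖ = q k := by
    rw [Pi.norm_single, Int.norm_eq_abs]; simp
  refine (psi_le (Pi.single i (q k : ℤ)) (-(p k)) (hq1.trans hnorm.ge) (hnorm.le.trans ht)).trans
    (le_of_eq ?_)
  rw [sum_eq_single i (fun j _ hj => by simp [Pi.single_eq_of_ne hj]) (by simp)]
  rw [Pi.single_eq_same, hi]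
  push_cast
  rw [← sub_eq_add_neg, abs_of_nonneg (h.err_nonneg hc k)]

/-- At the parameters `k` for which `q k * q (k + 1) * θ` has no short almost relation, the form
`q k * z k - p k` remains the best approximation until just before `q (k + 1)`. -/
lemma le_psi_extend (h : Interlaced (d + 2) c p q z) (hc0 : 0 ≤ c) (hc1 : c ≤ 1) {c' : ℝ}
    (hc' : c' ≤ 1) {k : ℕ} (hk : (c + 1) ≤ (c' - c - 1 / ((k : ℝ) + 1)) * (k + 1))
    {θ : Fin d → ℝ} (hθ : ((q k * q (k + 1) : ℕ) : ℝ) • θ ∈ AvoidSet d (q (k + 1)) c') :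
    c / (q (k + 1) : ℝ) ^ (d + 2) ≤ psi (extend θ (z 0) (z 1)) ((q (k + 1) : ℝ) - 1) := by
  have hr2 : (2 : ℝ) < q (k + 1) := by exact_mod_cast h.two_lt (k + 1)
  have hk0 : (0 : ℝ) < 1 / ((k : ℝ) + 1) := by positivity
  have hgap0 : 0 ≤ c' - c - 1 / ((k : ℝ) + 1) := by
    by_contra! hneg
    have : (c' - c - 1 / ((k : ℝ) + 1)) * (k + 1) < 0 := mul_neg_of_neg_of_pos hneg (by positivity)
    linarith
  have hgap : (c + 1) * q k ≤ (c' - c - 1 / ((k : ℝ) + 1)) * q (k + 1) := by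
    calc (c + 1) * q k ≤ (c' - c - 1 / ((k : ℝ) + 1)) * (k + 1) * q k := by gcongr
      _ = (c' - c - 1 / ((k : ℝ) + 1)) * ((k + 1) * q k) := by ring
      _ ≤ _ := mul_le_mul_of_nonneg_left (h.growth_real k) hgap0
  have hx : q (k + 1) * z (k + 1) - p (k + 1) ≤ 1 / (q (k + 1) : ℝ) ^ (d + 2) := by
    have h1 := h.err_le (k + 1)
    have h2 := h.growth_real (k + 1)
    have hq1 := h.q_pos (k + 1)
    push_cast at h1 h2
    have h3 : 1 / ((k : ℝ) + 1 + 1) ≤ 1 := by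
      rw [div_le_one (by positivity)]; linarith [(Nat.cast_nonneg k : (0 : ℝ) ≤ k)]
    have h4 : 2 * (q (k + 1) : ℝ) ^ (d + 2) ≤ (q (k + 1 + 1) : ℝ) ^ (d + 2) := by
      have h5 : 2 * (q (k + 1) : ℝ) ≤ q (k + 1 + 1) := by
        refine le_trans ?_ h2
        have : (0 : ℝ) ≤ k := Nat.cast_nonneg k
        gcongr
        linarith
      calc 2 * (q (k + 1) : ℝ) ^ (d + 2) ≤ 2 ^ (d + 2) * (q (k + 1) : ℝ) ^ (d + 2) := by
            gcongr
            exact le_self_pow₀ (by norm_num) (by omega)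
        _ = (2 * (q (k + 1) : ℝ)) ^ (d + 2) := by rw [mul_pow]
        _ ≤ _ := by gcongr
    refine h1.trans ?_
    rw [div_le_div_iff₀ (by have := h.q_pos (k + 1 + 1); positivity) (by positivity)]
    nlinarith [pow_pos hq1 (d + 2)]
  refine le_psi (by linarith) fun b a hb0 hbt => ?_
  have hbr : ∀ i, |b i| < (q (k + 1) : ℤ) := by
    intro i
    have h1 := hbt i
    have h2 : (|b i| : ℝ) < q (k + 1) := by linarith
    exact_mod_cast h2
  rw [sum_mul_extend θ (z 0) (z 1) fun i => (b i : ℝ)]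
  have hne : (fun i : Fin d => b i.castSucc.castSucc) ≠ 0 ∨
      b (Fin.last d).castSucc ≠ 0 ∨ b (Fin.last (d + 1)) ≠ 0 := by
    by_contra! hall
    refine hb0 (funext fun i => ?_)
    refine Fin.lastCases hall.2.2 (fun i => ?_) i
    refine Fin.lastCases hall.2.1 (fun i => ?_) i
    exact congrFun hall.1 i
  have key : ∀ x y : ℝ, ∀ u v : ℤ, z (k + 1) = x → z k = y → |u| < (q (k + 1) : ℤ) →
      |v| < (q (k + 1) : ℤ) → ((fun i : Fin d => b i.castSucc.castSucc) ≠ 0 ∨ u ≠ 0 ∨ v ≠ 0) →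
      c / (q (k + 1) : ℝ) ^ (d + 2) ≤
        |∑ i : Fin d, (b i.castSucc.castSucc : ℝ) * θ i + u * x + v * y + a| := by
    rintro x y u v rfl rfl hu hv hne'
    exact le_abs_linear_form (h.prime k) (h.prime (k + 1)) (h.pos k) (h.lt k) (h.pos (k + 1))
      (h.lt (k + 1)) (h.lt_succ k) hc' hc0 (h.le_err k) (h.err_le k) (h.err_nonneg hc0 (k + 1)) hx
      hgap hθ _ u v a (fun i => hbr _) hu hv hne'
  have hpar : ∀ j, z (2 * j) = z 0 ∧ z (2 * j + 1) = z 1 := by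
    intro j
    induction j with
    | zero => exact ⟨rfl, rfl⟩
    | succ j ih =>
      refine ⟨by rw [← ih.1, mul_add, mul_one, h.period], ?_⟩
      rw [← ih.2, show 2 * (j + 1) + 1 = 2 * j + 1 + 2 by ring, h.period]
  -- the parity of `k` decides which of the last two coordinates is the closer one
  rcases Nat.even_or_odd' k with ⟨j, hj | hj⟩
  · have := key (z 1) (z 0) (b (Fin.last (d + 1))) (b (Fin.last d).castSucc)
      (by rw [hj, (hpar j).2]) (by rw [hj, (hpar j).1]) (hbr _) (hbr _) (by tauto)
    convert this using 2
    ring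
  · exact key (z 0) (z 1) (b (Fin.last d).castSucc) (b (Fin.last (d + 1)))
      (by rw [hj, show 2 * j + 1 + 1 = 2 * (j + 1) by ring, (hpar _).1])
      (by rw [hj, (hpar j).2]) (hbr _) (hbr _) hne

lemma exists_between (h : Interlaced n c p q z) {K : ℕ} {t : ℝ} (ht : q K ≤ t) :
    ∃ k ≥ K, q k ≤ t ∧ t < q (k + 1) := by
  classical
  have hex : ∃ m, t < q m := (h.tendsto_real.eventually_gt_atTop t).exists
  have hspec := Nat.find_spec hex
  have hK : K < Nat.find hex := by
    by_contra! hle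
    have : (q (Nat.find hex) : ℝ) ≤ q K := by exact_mod_cast h.strictMono.monotone hle
    linarith
  refine ⟨Nat.find hex - 1, by omega, ?_, ?_⟩
  · have := Nat.find_min hex (show Nat.find hex - 1 < Nat.find hex by omega)
    linarith
  · rwa [show Nat.find hex - 1 + 1 = Nat.find hex by omega]

lemma dirichletConst_le (h : Interlaced (d + 2) c p q z) (hc : 0 ≤ c) (θ : Fin d → ℝ) :
    dirichletConst (extend θ (z 0) (z 1)) ≤ c := by
  refine le_of_forall_gt_imp_ge_of_dense fun y hy => ?_
  obtain ⟨y', hy1, hy2⟩ := EReal.lt_iff_exists_real_btwn.1 hy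
  refine le_trans ?_ hy2.le
  have hcy : c < y' := by exact_mod_cast hy1
  obtain ⟨K, hK⟩ := exists_nat_one_div_lt (sub_pos.2 hcy)
  refine limsup_le_of_le (h := ?_)
  filter_upwards [eventually_ge_atTop (q K : ℝ)] with t ht
  obtain ⟨k, hk, h1, h2⟩ := h.exists_between ht
  have ht0 : 0 ≤ t := le_trans (Nat.cast_nonneg _) ht
  have hq := h.q_pos (k + 1)
  rw [EReal.coe_le_coe_iff]
  calc t ^ (d + 2) * psi (extend θ (z 0) (z 1)) t
      ≤ (q (k + 1) : ℝ) ^ (d + 2) * ((c + 1 / ((k : ℝ) + 1)) / (q (k + 1) : ℝ) ^ (d + 2)) := by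
        have := psi_nonneg (extend θ (z 0) (z 1)) t
        exact mul_le_mul (pow_le_pow_left₀ ht0 h2.le _) (h.psi_extend_le hc θ k h1) this
          (by positivity)
    _ = c + 1 / ((k : ℝ) + 1) := by field_simp
    _ ≤ c + 1 / ((K : ℝ) + 1) := by
        have : (K : ℝ) ≤ k := by exact_mod_cast hk
        gcongr
    _ ≤ y' := by linarith

lemma notMem_bad (h : Interlaced (d + 2) c p q z) (hc : 0 ≤ c) (hc1 : c ≤ 1) (θ : Fin d → ℝ) :
    extend θ (z 0) (z 1) ∉ Bad (d + 2) := by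
  simp only [Bad, Set.mem_ofPred_eq, not_lt]
  refine le_of_forall_gt_imp_ge_of_dense fun y hy => ?_
  obtain ⟨y', hy1, hy2⟩ := EReal.lt_iff_exists_real_btwn.1 hy
  refine le_trans ?_ hy2.le
  have hy0 : 0 < y' := by exact_mod_cast hy1
  refine liminf_le_of_frequently_le' ?_
  refine h.tendsto_real.frequently (Eventually.frequently ?_)
  have hlim : Tendsto (fun k : ℕ => 2 * (1 / ((k : ℝ) + 1))) atTop (𝓝 (2 * 0)) :=
    tendsto_one_div_add_atTop_nhds_zero_nat.const_mul 2
  filter_upwards [hlim.eventually_lt_const (show 2 * 0 < y' by simpa using hy0)] with k hk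
  rw [EReal.coe_le_coe_iff]
  have hq := h.q_pos (k + 1)
  have hq0 := h.q_pos k
  have hk1 : 1 / ((k : ℝ) + 1) ≤ 1 := by
    rw [div_le_one (by positivity)]; linarith [(Nat.cast_nonneg k : (0 : ℝ) ≤ k)]
  have hratio : (q k : ℝ) / q (k + 1) ≤ 1 / ((k : ℝ) + 1) := by
    rw [div_le_div_iff₀ hq (by positivity)]
    linarith [h.growth_real k]
  have hr0 : (0 : ℝ) ≤ (q k : ℝ) / q (k + 1) := by positivity
  calc (q k : ℝ) ^ (d + 2) * psi (extend θ (z 0) (z 1)) (q k)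
      ≤ (q k : ℝ) ^ (d + 2) * ((c + 1 / ((k : ℝ) + 1)) / (q (k + 1) : ℝ) ^ (d + 2)) := by
        gcongr
        exact h.psi_extend_le hc θ k le_rfl
    _ = (c + 1 / ((k : ℝ) + 1)) * ((q k : ℝ) / q (k + 1)) ^ (d + 2) := by
        rw [div_pow]; ring
    _ ≤ 2 * (1 / ((k : ℝ) + 1)) := by
        refine mul_le_mul (by linarith) ?_ (by positivity) (by norm_num)
        exact (pow_le_of_le_one hr0 (hratio.trans hk1) (by omega)).trans hratio
    _ ≤ y' := hk.le

/-- A point `θ` whose multiples by `q k * q (k + 1)` infinitely often have no short almost relation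
extends to a point of the Folklore set. -/
theorem extend_mem_FS (h : Interlaced (d + 2) c p q z) (hc0 : 0 ≤ c) {c' : ℝ} (hcc' : c < c')
    (hc' : c' ≤ 1) {θ : Fin d → ℝ}
    (hθ : ∃ᶠ k in atTop, ((q k * q (k + 1) : ℕ) : ℝ) • θ ∈ AvoidSet d (q (k + 1)) c') :
    extend θ (z 0) (z 1) ∈ FS (d + 2) c := by
  have hc1 : c ≤ 1 := hcc'.le.trans hc'
  refine ⟨le_antisymm (h.dirichletConst_le hc0 θ) ?_, h.notMem_bad hc0 hc1 θ⟩
  refine le_of_forall_lt_imp_le_of_dense fun y hy => ?_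
  obtain ⟨y', hy1, hy2⟩ := EReal.lt_iff_exists_real_btwn.1 hy
  refine hy1.le.trans ?_
  have hyc : y' < c := by exact_mod_cast hy2
  -- norms of integer vectors are integers, so the height `q (k + 1) - 1` excludes just those of
  -- norm at least `q (k + 1)`
  have htend : Tendsto (fun k => (q (k + 1) : ℝ) - 1) atTop atTop :=
    tendsto_atTop_add_const_right _ _ (h.tendsto_real.comp (tendsto_add_atTop_nat 1))
  refine le_limsup_of_frequently_le' (htend.frequently ?_)
  have hgap : ∀ᶠ k : ℕ in atTop, c + 1 ≤ (c' - c - 1 / ((k : ℝ) + 1)) * (k + 1) := by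
    have h1 : Tendsto (fun k : ℕ => (c' - c) * (k : ℝ)) atTop atTop :=
      tendsto_natCast_atTop_atTop.const_mul_atTop (sub_pos.2 hcc')
    filter_upwards [h1.eventually_ge_atTop (c + 2)] with k hk
    have e : (c' - c - 1 / ((k : ℝ) + 1)) * (k + 1) = (c' - c) * k + (c' - c) - 1 := by
      field_simp
    rw [e]
    linarith
  have hlim : Tendsto (fun k => c * (1 - (q (k + 1) : ℝ)⁻¹) ^ (d + 2)) atTop
      (𝓝 (c * (1 - 0) ^ (d + 2))) :=
    (((tendsto_inv_atTop_zero.comp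
      (h.tendsto_real.comp (tendsto_add_atTop_nat 1))).const_sub 1).pow _).const_mul c
  have hnear := hlim.eventually_const_lt (show y' < c * (1 - 0) ^ (d + 2) by simpa using hyc)
  refine (hθ.and_eventually (hgap.and hnear)).mono fun k ⟨hk1, hk2, hk3⟩ => ?_
  rw [EReal.coe_le_coe_iff]
  have hq := h.q_pos (k + 1)
  have hr2 : (2 : ℝ) < q (k + 1) := by exact_mod_cast h.two_lt (k + 1)
  calc y' ≤ c * (1 - (q (k + 1) : ℝ)⁻¹) ^ (d + 2) := hk3.le
    _ = ((q (k + 1) : ℝ) - 1) ^ (d + 2) * (c / (q (k + 1) : ℝ) ^ (d + 2)) := by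
        rw [show (1 - (q (k + 1) : ℝ)⁻¹) = ((q (k + 1) : ℝ) - 1) / q (k + 1) by field_simp, div_pow]
        ring
    _ ≤ _ := by
        have : (0 : ℝ) ≤ (q (k + 1) : ℝ) - 1 := by linarith
        gcongr
        exact h.le_psi_extend hc0 hc1 hc' hk2 hk1

end Interlaced

end Folklore

namespace Folklore

open MeasureTheory

/-! ### The threshold and the Hausdorff dimension -/

lemma threshold_pos {n : ℕ} (hn : 4 ≤ n) : 0 < threshold n := by
  have hnR : (4 : ℝ) ≤ n := by exact_mod_cast hn
  have h1 : (0 : ℝ) < n - 3 := by linarith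
  have h2 : (0 : ℝ) < n - 2 := by linarith
  have h3 : 0 < Real.Gamma ((n : ℝ) - 1 / 2) := Real.Gamma_pos_of_pos (by linarith)
  have h4 : 0 < Real.Gamma (n : ℝ) := Real.Gamma_pos_of_pos (by linarith)
  unfold threshold
  have := Real.pi_pos
  positivity

lemma threshold_lt_one {n : ℕ} (hn : 4 ≤ n) : threshold n < 1 := by
  have hnR : (4 : ℝ) ≤ n := by exact_mod_cast hn
  have h1 : (0 : ℝ) < n - 3 := by linarith
  have h2 : (1 : ℝ) ≤ n - 2 := by linarith
  have h3 : 0 < Real.Gamma ((n : ℝ) - 1 / 2) := Real.Gamma_pos_of_pos (by linarith)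
  have h4 : 0 < Real.Gamma (n : ℝ) := Real.Gamma_pos_of_pos (by linarith)
  have hΓ : Real.Gamma ((n : ℝ) - 1 / 2) / Real.Gamma (n : ℝ) ≤ 1 := by
    rw [div_le_one h4]
    exact (Real.Gamma_strictMonoOn_Ici (Set.mem_Ici.2 (by linarith)) (Set.mem_Ici.2 (by linarith))
      (by linarith)).le
  have hπ : √Real.pi ≤ 2 := by
    rw [Real.sqrt_le_left (by norm_num)]
    linarith [Real.pi_le_four]
  have hpow : (n : ℝ) - 2 ≤ ((n : ℝ) - 2) ^ (3 / 2 : ℝ) := by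
    conv_lhs => rw [← Real.rpow_one ((n : ℝ) - 2)]
    exact Real.rpow_le_rpow_of_exponent_le h2 (by norm_num)
  have hfrac : ((n : ℝ) - 3) / (8 * ((n : ℝ) - 2) ^ (3 / 2 : ℝ)) ≤ 1 / 8 := by
    rw [div_le_div_iff₀ (by positivity) (by norm_num)]
    linarith
  calc threshold n ≤ 1 / 8 * 2 * 1 := by
        unfold threshold
        gcongr
    _ < 1 := by norm_num

lemma le_dimH_of_volume_ne_zero {d : ℕ} {s : Set (Fin d → ℝ)} (h : volume s ≠ 0) :
    (d : ℝ≥0∞) ≤ dimH s := by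
  have h1 : Measure.hausdorffMeasure ((d : NNReal) : ℝ) s ≠ 0 := by
    have h2 := hausdorffMeasure_pi_real (ι := Fin d)
    rw [Fintype.card_fin] at h2
    simpa [h2] using h
  simpa using le_dimH_of_hausdorffMeasure_ne_zero h1

/-- For every `c < 1` the Folklore set contains a graph over a set of positive volume. -/
theorem le_dimH_FS {d : ℕ} (hd : 1 ≤ d) {c : ℝ} (hc0 : 0 ≤ c) (hc1 : c < 1) :
    (d : ℝ≥0∞) ≤ dimH (FS (d + 2) c) := by
  obtain ⟨p, q, z, h⟩ := exists_interlaced (d + 2) hc0 hc1.le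
  -- any constant strictly between `c` and `1` would do
  obtain ⟨v, hv, R, hR⟩ :=
    exists_volume_avoidSet_ge hd (c := (1 + c) / 2) (by linarith) (by linarith)
  let E : ℕ → Set (Fin d → ℝ) := fun k =>
    ScaledAvoidSet d (q (k + 1)) (q k * q (k + 1)) ((1 + c) / 2)
  have hvol : ENNReal.ofReal v ≤ volume {θ : Fin d → ℝ | ∃ᶠ k in atTop, θ ∈ E k} := by
    refine le_measure_setOf_frequently (fun k => measurableSet_scaledAvoidSet _ _ _ _)
      (U := Metric.ball 0 (1 / 2)) measure_ball_lt_top.ne (fun k θ hθ => hθ.1) ?_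
    filter_upwards
      [(h.strictMono.tendsto_atTop.comp (tendsto_add_atTop_nat 1)).eventually_ge_atTop R] with k hk
    -- the primes exceed `2`, so that the scaling factor is odd
    have hodd : ∀ j, Odd (q j) := fun j => (h.prime j).odd_of_ne_two (h.two_lt j).ne'
    obtain ⟨m, hm⟩ := (hodd k).mul (hodd (k + 1))
    change _ ≤ volume (ScaledAvoidSet _ _ _ _)
    rw [hm]
    exact (hR _ hk).trans (volume_scaledAvoidSet_ge _ _ _ _)
  refine (le_dimH_of_volume_ne_zero
    ((ENNReal.ofReal_pos.2 hv).trans_le hvol).ne').trans ?_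
  let π : (Fin (d + 2) → ℝ) → Fin d → ℝ := fun ξ i => ξ i.castSucc.castSucc
  have hπ : LipschitzWith 1 π := LipschitzWith.of_dist_le_mul fun ξ ξ' => by
    rw [NNReal.coe_one, one_mul, dist_pi_le_iff dist_nonneg]
    exact fun i => dist_le_pi_dist ξ ξ' _
  refine le_trans (dimH_mono ?_) (hπ.dimH_image_le (FS (d + 2) c))
  intro θ hθ
  refine ⟨extend θ (z 0) (z 1), h.extend_mem_FS hc0 (c' := (1 + c) / 2) (by linarith) (by linarith)
    (hθ.mono fun k hk => hk.2), ?_⟩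
  funext i
  simp [π, extend]

end Folklore

theorem theorem2p2 (n : ℕ) (hn : 4 ≤ n) :
    (0 < Folklore.threshold n ∧ Folklore.threshold n < 1) ∧
      ∀ c : ℝ, 0 ≤ c → c < Folklore.threshold n →
        ((n - 2 : ℕ) : ℝ≥0∞) ≤ dimH (Folklore.FS n c) := by
  refine ⟨⟨Folklore.threshold_pos hn, Folklore.threshold_lt_one hn⟩, fun c hc0 hc => ?_⟩
  obtain ⟨d, rfl⟩ : ∃ d, n = d + 2 := ⟨n - 2, by omega⟩
  rw [Nat.add_sub_cancel]
  exact Folklore.le_dimH_FS (by omega) hc0 (hc.trans (Folklore.threshold_lt_one hn))
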